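/- **Conventions.** $G$ is a (discrete) abelian group, written additively. A *partial action* $\beta$ of $G$ on a locally compact Hausdorff space $X$ is a family of homeomorphisms $\beta_t\colon D_{-t}\to D_t$ ($t\in G$) between open subsets of $X$ such that for all $s,t\in G$: $\beta_s(D_{-s}\cap D_t)=D_s\cap D_{s+t}$; $\beta_t(D_{-t}\cap D_{-s-t})=D_t\cap D_{-s}$; $\beta_{s+t}(x)=\beta_s(\beta_t(x))$ for $x\in D_{-t}\cap D_{-s-t}$; and $D_0=X$, $\beta_0=\mathrm{id}_X$. The *partial crossed product* $C_0(X)\times_\beta G$ is the completion of the $*$-algebra of polynomials $\sum f_nU^n$ (finite sums, $f_n\in C_0(X)$ vanishing off $D_n$), where $fU^n\,gU^m=hU^{n+m}$ with $h=f\cdot(g\circ\beta_n^{-1})$ on $D_n$ and $h=0$ off $D_n$, and $(fU^n)^*=kU^{-n}$ with $k=\overline{f\circ\beta_n}$ on $D_{-n}$ and $k=0$ off $D_{-n}$, in the norm $\|x\|=\sup_\pi\|\pi(x)\|$ over all $*$-representations $\pi$ of this algebra on Hilbert spaces that are continuous for $\|\sum f_nU^n\|_L=\sum\|f_n\|$.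 A *positive cone* is a subset $\Sigma\subseteq G$ with $\Sigma+\Sigma\subseteq\Sigma$, $\Sigma\cap-\Sigma=\{0\}$ and $G=\Sigma-\Sigma$; the *analytic crossed product* $C_0(X)\times_\beta\Sigma$ is the closure in $C_0(X)\times_\beta G$ of the polynomials $\sum f_nU^n$ with all $n$ in $\Sigma$. If $\beta$, $\hat\beta$ are partial actions of $G$ on $X$, $\hat X$ with domains $D_{-g}$, $\hat D_{-g}$, a map $\phi\colon\hat X\to X$ *intertwines* them if for all $g\in G$ and $x\in\hat X$ one has $\phi(x)\in D_g\iff x\in\hat D_g$, and $\beta_g(\phi(x))=\phi(\hat\beta_g(x))$ for $x\in\hat D_{-g}$. A map is *proper* if inverse images of compact sets are compact. **Proposition.** Fix an abelian group $G$. 1. Let $\beta$, $\hat\beta$ be partial actions of $G$ on locally compact Hausdorff spaces $X$, $\hat X$, and let $\phi\colon\hat X\to X$ be a proper continuous surjection which intertwines them. Then there is a unique $*$-homomorphism $\Phi\colon C_0(X)\times_\beta G\to C_0(\hat X)\times_{\hat\beta}G$ with $\Phi(fU^n)=(f\circ\phi)U^n$ for all monomials $fU^n$, and $\Phi$ is continuous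 and injective. 2. Let $(X_i,\phi_i)$ be an inverse sequence of locally compact Hausdorff spaces in which each $\phi_i\colon X_{i+1}\to X_i$ is a proper continuous surjection, let $\beta_i$ be partial actions of $G$ on $X_i$ such that each $\phi_i$ intertwines $\beta_{i+1}$ and $\beta_i$, and let $\Phi_i\colon C_0(X_i)\times_{\beta_i}G\to C_0(X_{i+1})\times_{\beta_{i+1}}G$ be the map induced by $\phi_i$ as in (1). Let $X=\varprojlim(X_i,\phi_i)$, with projections $p_i\colon X\to X_i$. Then $X$ is locally compact, and there is a partial action $\beta$ of $G$ on $X$ such that each $p_i$ is a proper continuous surjection intertwining $\beta$ and $\beta_i$ and such that $C_0(X)\times_\beta G$, with the maps $\Psi_i\colon C_0(X_i)\times_{\beta_i}G\to C_0(X)\times_\beta G$, $fU^n\mapsto(f\circ p_i)U^n$, is the direct limit of the sequence $(C_0(X_i)\times_{\beta_i}G,\Phi_i)$ in the category of C$^*$-algebras and $*$-homomorphisms. 3. For $\beta$, $\Phi_i$, $\Psi_i$ as in (2) and every positive cone $\Sigma$ in $G$, $\Phi_i$ maps $C_0(X_i)\times_{\beta_i}\Sigma$ into $C_0(X_{i+1})\times_{\beta_{i+1}}\Sigma$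 for every $i$, and $C_0(X)\times_\beta\Sigma$ is the closure of $\bigcup_i\Psi_i\big(C_0(X_i)\times_{\beta_i}\Sigma\big)$ and, with the restrictions of the maps $\Psi_i$, is the direct limit of the sequence $C_0(X_i)\times_{\beta_i}\Sigma$ with the restrictions of the maps $\Phi_i$, in the category of Banach algebras and contractive homomorphisms. -/

import Mathlib

open Topology Filter
open scoped DirectSum ZeroAtInfty

universe u v w

/-- A partial action of the (discrete) abelian group `G` on the topological space `X`: a family of
homeomorphisms `β_t = map t : D_{-t} → D_t` between open subsets of `X` such that
`β_s (D_{-s} ∩ D_t) = D_s ∩ D_{s+t}`, `β_t (D_{-t} ∩ D_{-s-t}) = D_t ∩ D_{-s}`,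
`β_{s+t} = β_s ∘ β_t` on `D_{-t} ∩ D_{-s-t}`, `D_0 = X` and `β_0 = id`.
The values of `map t` outside its source `D_{-t}` carry no meaning. -/
structure PartialAction (G : Type v) [AddCommGroup G] (X : Type u) [TopologicalSpace X] where
  /-- the open set `D_t` -/
  dom : G → Set X
  /-- the homeomorphism `β_t : D_{-t} → D_t` -/
  map : G → OpenPartialHomeomorph X X
  map_source : ∀ t, (map t).source = dom (-t)
  map_target : ∀ t, (map t).target = dom t
  image_inter_left : ∀ s t, map s '' (dom (-s) ∩ dom t) = dom s ∩ dom (s + t)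
  image_inter_right : ∀ s t, map t '' (dom (-t) ∩ dom (-s - t)) = dom t ∩ dom (-s)
  map_add : ∀ s t, ∀ x ∈ dom (-t) ∩ dom (-s - t), map (s + t) x = map s (map t x)
  dom_zero : dom 0 = Set.univ
  map_zero : ∀ x, map 0 x = x

noncomputable section

namespace PartialAction

section Basic

variable {G : Type v} [AddCommGroup G] {X : Type u} [TopologicalSpace X] (β : PartialAction G X)

theorem isOpen_dom (t : G) : IsOpen (β.dom t) := by
  rw [← β.map_target t]; exact (β.map t).open_target

theorem map_mem {t : G} {x : X} (hx : x ∈ β.dom (-t)) : β.map t x ∈ β.dom t := by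
  rw [← β.map_target t]; exact (β.map t).map_source (by rwa [β.map_source])

theorem symm_mem {t : G} {x : X} (hx : x ∈ β.dom t) : (β.map t).symm x ∈ β.dom (-t) := by
  rw [← β.map_source t]; exact (β.map t).map_target (by rwa [β.map_target])

theorem map_symm {t : G} {x : X} (hx : x ∈ β.dom t) : β.map t ((β.map t).symm x) = x :=
  (β.map t).right_inv (by rwa [β.map_target])

theorem symm_map {t : G} {x : X} (hx : x ∈ β.dom (-t)) : (β.map t).symm (β.map t x) = x :=
  (β.map t).left_inv (by rwa [β.map_source])

theorem neg_map {t : G} {x : X} (hx : x ∈ β.dom (-t)) : β.map (-t) (β.map t x) = x := by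
  rw [← β.map_add (-t) t x ⟨hx, by simp [β.dom_zero]⟩, neg_add_cancel, β.map_zero]

theorem symm_eq {t : G} {x : X} (hx : x ∈ β.dom t) : (β.map t).symm x = β.map (-t) x := by
  have h := β.neg_map (β.symm_mem hx)
  rwa [β.map_symm hx, eq_comm] at h

/-- If `x ∈ D_n`, then `β_n⁻¹ x ∈ D_m` exactly when `x ∈ D_{n+m}`. -/
theorem symm_mem_iff {n m : G} {x : X} (hx : x ∈ β.dom n) :
    (β.map n).symm x ∈ β.dom m ↔ x ∈ β.dom (n + m) := by
  constructor
  · intro h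
    have := (β.image_inter_left n m).subset ⟨_, ⟨β.symm_mem hx, h⟩, rfl⟩
    rw [β.map_symm hx] at this
    exact this.2
  · intro h
    obtain ⟨y, hy, rfl⟩ := (β.image_inter_left n m).superset ⟨hx, h⟩
    rw [β.symm_map hy.1]
    exact hy.2

theorem symm_symm {n m : G} {x : X} (hx : x ∈ β.dom n) (hx' : x ∈ β.dom (n + m)) :
    (β.map m).symm ((β.map n).symm x) = (β.map (n + m)).symm x := by
  have h1 := (β.symm_mem_iff hx).2 hx'
  rw [β.symm_eq h1, β.symm_eq hx, β.symm_eq hx', neg_add_rev,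
    β.map_add (-m) (-n) x ⟨by simpa using hx, by simpa [add_comm] using hx'⟩]

theorem symm_zero (x : X) : (β.map 0).symm x = x := by
  have h : x ∈ β.dom 0 := by simp [β.dom_zero]
  rw [β.symm_eq h, neg_zero, β.map_zero]

/-- The ideal `D_t` of `C₀(X)`: the functions vanishing off the open set `D_t`. -/
def ideal (t : G) : Submodule ℂ C₀(X, ℂ) where
  carrier := {f | ∀ x, x ∉ β.dom t → f x = 0}
  add_mem' hf hg x hx := by simp [hf x hx, hg x hx]
  zero_mem' x _ := rfl
  smul_mem' c f hf x hx := by simp [hf x hx]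

/-- The ideal `D_t` of `C₀(X)` as a type. -/
def Coeff (t : G) : Type u := ideal β t

instance (t : G) : AddCommGroup (β.Coeff t) := inferInstanceAs (AddCommGroup (β.ideal t))

instance (t : G) : Module ℂ (β.Coeff t) := inferInstanceAs (Module ℂ (β.ideal t))

variable {β}

@[simp] theorem add_val {t : G} (f g : β.Coeff t) : (f + g).1 = f.1 + g.1 := rfl

@[simp] theorem zero_val {t : G} : (0 : β.Coeff t).1 = 0 := rfl

@[simp] theorem smul_val {t : G} (c : ℂ) (f : β.Coeff t) : (c • f).1 = c • f.1 := rfl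

theorem ideal_apply {t : G} (f : β.Coeff t) {x : X} (hx : x ∉ β.dom t) : f.1 x = 0 := f.2 x hx

/-- The coefficient `h` in `f U^n g U^m = h U^(n+m)`: `h x = f x * g (β_n⁻¹ x)` for `x ∈ D_n`
(this vanishes unless `x ∈ D_n ∩ D_{n+m}`), and `h x = 0` otherwise. That is,
`h = α_n (α_{-n} f * g)` for the dual action `α` on `C₀(X)`. -/
def mulFun (n m : G) (f : β.Coeff n) (g : β.Coeff m) (x : X) : ℂ :=
  (β.dom n).indicator (fun x => f.1 x * g.1 ((β.map n).symm x)) x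

theorem mulFun_of_mem {n m : G} (f : β.Coeff n) (g : β.Coeff m) {x : X} (hx : x ∈ β.dom n) :
    mulFun n m f g x = f.1 x * g.1 ((β.map n).symm x) := Set.indicator_of_mem hx _

theorem mulFun_of_notMem {n m : G} (f : β.Coeff n) (g : β.Coeff m) {x : X} (hx : x ∉ β.dom n) :
    mulFun n m f g x = 0 := Set.indicator_of_notMem hx _

theorem norm_apply_le_norm (f : C₀(X, ℂ)) (x : X) : ‖f x‖ ≤ ‖f‖ := by
  rw [← ZeroAtInftyContinuousMap.norm_toBCF_eq_norm]
  exact f.toBCF.norm_coe_le_norm x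

theorem norm_le_of_forall {f : C₀(X, ℂ)} {C : ℝ} (hC : 0 ≤ C) (h : ∀ x, ‖f x‖ ≤ C) : ‖f‖ ≤ C := by
  rw [← ZeroAtInftyContinuousMap.norm_toBCF_eq_norm]
  exact (BoundedContinuousFunction.norm_le hC).2 h

theorem norm_mulFun_le {n m : G} (f : β.Coeff n) (g : β.Coeff m) (x : X) :
    ‖mulFun n m f g x‖ ≤ ‖f.1 x‖ * ‖g.1‖ := by
  by_cases hx : x ∈ β.dom n
  · rw [mulFun_of_mem f g hx, norm_mul]
    gcongr
    exact norm_apply_le_norm _ _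
  · rw [mulFun_of_notMem f g hx, norm_zero]
    positivity

theorem continuous_mulFun {n m : G} (f : β.Coeff n) (g : β.Coeff m) :
    Continuous (mulFun n m f g) := by
  rw [continuous_iff_continuousAt]
  intro x
  by_cases hx : x ∈ β.dom n
  · have hn : β.dom n ∈ 𝓝 x := (β.isOpen_dom n).mem_nhds hx
    have h1 : ContinuousAt (fun x => f.1 x * g.1 ((β.map n).symm x)) x := by
      refine (map_continuous f.1).continuousAt.mul ?_
      refine (map_continuous g.1).continuousAt.comp ?_
      exact (β.map n).symm.continuousAt (by simpa [β.map_target] using hx)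
    refine h1.congr ?_
    filter_upwards [hn] with y hy
    rw [mulFun_of_mem f g hy]
  · have h0 : mulFun n m f g x = 0 := mulFun_of_notMem f g hx
    rw [ContinuousAt, h0]
    refine squeeze_zero_norm (norm_mulFun_le f g) ?_
    have : Tendsto (fun y => ‖f.1 y‖ * ‖g.1‖) (𝓝 x) (𝓝 (‖f.1 x‖ * ‖g.1‖)) :=
      ((map_continuous f.1).norm.mul continuous_const).tendsto x
    simpa [ideal_apply f hx] using this

/-- `mulFun` as an element of the ideal `D_{n+m}`. -/
def mulCoeff (n m : G) (f : β.Coeff n) (g : β.Coeff m) : β.Coeff (n + m) where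
  val :=
    { toFun := mulFun n m f g
      continuous_toFun := continuous_mulFun f g
      zero_at_infty' := by
        refine squeeze_zero_norm (norm_mulFun_le f g) ?_
        have : Tendsto (fun y => ‖f.1 y‖ * ‖g.1‖) (cocompact X) (𝓝 (‖(0 : ℂ)‖ * ‖g.1‖)) :=
          (zero_at_infty f.1).norm.mul tendsto_const_nhds
        simpa using this }
  property x hx := by
    change mulFun n m f g x = 0
    by_cases h : x ∈ β.dom n
    · rw [mulFun_of_mem f g h, ideal_apply g (fun h' => hx ((β.symm_mem_iff h).1 h')), mul_zero]
    · exact mulFun_of_notMem f g h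

theorem mulCoeff_of_mem {n m : G} (f : β.Coeff n) (g : β.Coeff m) {x : X} (hx : x ∈ β.dom n) :
    (mulCoeff n m f g).1 x = f.1 x * g.1 ((β.map n).symm x) := mulFun_of_mem f g hx

theorem mulCoeff_of_notMem {n m : G} (f : β.Coeff n) (g : β.Coeff m) {x : X}
    (hx : x ∉ β.dom n) : (mulCoeff n m f g).1 x = 0 := mulFun_of_notMem f g hx

theorem ideal_ext {t : G} {f g : β.Coeff t} (h : ∀ x, f.1 x = g.1 x) : f = g :=
  Subtype.ext (DFunLike.ext _ _ h)

/-- The coefficient in `(f U^n)^* = α_{-n}(conj f) U^(-n)`: its value is `conj (f (β_n x))` for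
`x ∈ D_{-n}`, and `0` otherwise. -/
def starFun (n : G) (f : β.Coeff n) (x : X) : ℂ :=
  (β.dom (-n)).indicator (fun x => star (f.1 (β.map n x))) x

theorem starFun_of_mem {n : G} (f : β.Coeff n) {x : X} (hx : x ∈ β.dom (-n)) :
    starFun n f x = star (f.1 (β.map n x)) := Set.indicator_of_mem hx _

theorem starFun_of_notMem {n : G} (f : β.Coeff n) {x : X} (hx : x ∉ β.dom (-n)) :
    starFun n f x = 0 := Set.indicator_of_notMem hx _

theorem isCompact_le_norm (f : C₀(X, ℂ)) {ε : ℝ} (hε : 0 < ε) : IsCompact {x | ε ≤ ‖f x‖} := by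
  have h : ∀ᶠ x in cocompact X, ‖f x‖ < ε := by
    have := (zero_at_infty f).norm
    rw [norm_zero] at this
    exact this.eventually_lt_const hε
  obtain ⟨K, hK, hK'⟩ := mem_cocompact.1 h
  refine hK.of_isClosed_subset (isClosed_le continuous_const (map_continuous f).norm) ?_
  intro x hx
  by_contra hxK
  exact (lt_irrefl ε) (lt_of_le_of_lt hx (hK' hxK))

theorem isCompact_le_norm_starFun {n : G} (f : β.Coeff n) {ε : ℝ} (hε : 0 < ε) :
    IsCompact {x | ε ≤ ‖starFun n f x‖} := by
  have hsub : {x | ε ≤ ‖f.1 x‖} ⊆ β.dom n := by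
    intro x hx
    by_contra h
    rw [Set.mem_ofPred_eq, ideal_apply f h, norm_zero] at hx
    exact absurd hx (not_le.2 hε)
  have : {x | ε ≤ ‖starFun n f x‖} = (β.map n).symm '' {x | ε ≤ ‖f.1 x‖} := by
    ext x
    constructor
    · intro hx
      by_cases h : x ∈ β.dom (-n)
      · refine ⟨β.map n x, ?_, β.symm_map h⟩
        simpa [starFun_of_mem f h] using hx
      · rw [Set.mem_ofPred_eq, starFun_of_notMem f h, norm_zero] at hx
        exact absurd hx (not_le.2 hε)
    · rintro ⟨y, hy, rfl⟩
      have hyn := hsub hy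
      rw [Set.mem_ofPred_eq, starFun_of_mem f (β.symm_mem hyn), β.map_symm hyn, norm_star]
      exact hy
  rw [this]
  refine (isCompact_le_norm f.1 hε).image_of_continuousOn ?_
  refine (β.map n).symm.continuousOn.mono ?_
  simpa [β.map_target] using hsub

theorem continuous_starFun [T2Space X] {n : G} (f : β.Coeff n) : Continuous (starFun n f) := by
  rw [continuous_iff_continuousAt]
  intro x
  by_cases hx : x ∈ β.dom (-n)
  · have h1 : ContinuousAt (fun x => star (f.1 (β.map n x))) x := by
      refine ContinuousAt.star ?_
      refine (map_continuous f.1).continuousAt.comp ?_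
      exact (β.map n).continuousAt (by simpa [β.map_source] using hx)
    refine h1.congr ?_
    filter_upwards [(β.isOpen_dom (-n)).mem_nhds hx] with y hy
    rw [starFun_of_mem f hy]
  · have h0 : starFun n f x = 0 := starFun_of_notMem f hx
    rw [ContinuousAt, h0, Metric.tendsto_nhds]
    intro ε hε
    have : {x | ε ≤ ‖starFun n f x‖}ᶜ ∈ 𝓝 x :=
      (isCompact_le_norm_starFun f hε).isClosed.isOpen_compl.mem_nhds (by simp [h0, hε])
    filter_upwards [this] with y hy
    simpa using hy

/-- `starFun` as an element of the ideal `D_{-n}`. -/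
def starCoeff [T2Space X] (n : G) (f : β.Coeff n) : β.Coeff (-n) where
  val :=
    { toFun := starFun n f
      continuous_toFun := continuous_starFun f
      zero_at_infty' := by
        rw [Metric.tendsto_nhds]
        intro ε hε
        filter_upwards [(isCompact_le_norm_starFun f hε).compl_mem_cocompact] with y hy
        simpa using hy }
  property _ hx := starFun_of_notMem f hx

theorem starCoeff_of_mem [T2Space X] {n : G} (f : β.Coeff n) {x : X} (hx : x ∈ β.dom (-n)) :
    (starCoeff n f).1 x = star (f.1 (β.map n x)) := starFun_of_mem f hx

theorem starCoeff_of_notMem [T2Space X] {n : G} (f : β.Coeff n) {x : X} (hx : x ∉ β.dom (-n)) :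
    (starCoeff n f).1 x = 0 := starFun_of_notMem f hx

/-- Multiplication of monomials, in the form used by `DirectSum`. -/
instance : DirectSum.GNonUnitalNonAssocSemiring (fun n : G => β.Coeff n) where
  mul {n m} f g := mulCoeff n m f g
  mul_zero {n m} f := by
    apply ideal_ext; intro x
    change mulFun n m f 0 x = 0
    by_cases hx : x ∈ β.dom n
    · simp [mulFun_of_mem f 0 hx]
    · simp [mulFun_of_notMem f 0 hx]
  zero_mul {n m} g := by
    apply ideal_ext; intro x
    change mulFun n m 0 g x = 0
    by_cases hx : x ∈ β.dom n
    · simp [mulFun_of_mem 0 g hx]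
    · simp [mulFun_of_notMem 0 g hx]
  mul_add {n m} f g h := by
    apply ideal_ext; intro x
    change mulFun n m f (g + h) x = mulFun n m f g x + mulFun n m f h x
    by_cases hx : x ∈ β.dom n
    · simp [mulFun_of_mem _ _ hx, mul_add]
    · simp [mulFun_of_notMem _ _ hx]
  add_mul {n m} f g h := by
    apply ideal_ext; intro x
    change mulFun n m (f + g) h x = mulFun n m f h x + mulFun n m g h x
    by_cases hx : x ∈ β.dom n
    · simp [mulFun_of_mem _ _ hx, add_mul]
    · simp [mulFun_of_notMem _ _ hx]

end Basic

section Poly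

variable {G : Type v} [AddCommGroup G] {X : Type u} [TopologicalSpace X]

/-- The algebra of formal polynomials `∑ f_n U^n`, `f_n ∈ D_n`, with finitely many nonzero terms. -/
def Poly (β : PartialAction G X) : Type max u v := ⨁ n : G, β.Coeff n

variable {β : PartialAction G X}

instance : AddCommGroup (Poly β) := inferInstanceAs (AddCommGroup (⨁ n : G, β.Coeff n))

instance : Module ℂ (Poly β) := inferInstanceAs (Module ℂ (⨁ n : G, β.Coeff n))

namespace Poly

/-- The coefficient `f_n` of a polynomial `∑ f_n U^n`. -/
def coeff (F : Poly β) (n : G) : β.Coeff n := (show ⨁ n : G, β.Coeff n from F) n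

open scoped Classical in
/-- The monomial `f U^n`, as an additive map in `f`. -/
def monoHom (n : G) : β.Coeff n →+ Poly β := DirectSum.of (fun n : G => β.Coeff n) n

/-- The monomial `f U^n`. -/
def mono (n : G) (f : β.Coeff n) : Poly β := monoHom n f

theorem mono_smul (n : G) (c : ℂ) (f : β.Coeff n) : mono n (c • f) = c • mono n f := by
  classical
  exact (DirectSum.lof ℂ G (fun n : G => β.Coeff n) n).map_smul c f

theorem mono_congr {n m : G} (h : n = m) {f : β.Coeff n} {g : β.Coeff m}
    (hfg : ∀ x, f.1 x = g.1 x) : mono n f = mono m g := by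
  subst h
  rw [ideal_ext hfg]

open scoped Classical in
/-- The bilinear product determined by `f U^n g U^m = mulCoeff n m f g U^(n+m)`, see
`mono_mul_mono`. -/
instance : NonUnitalNonAssocRing (Poly β) :=
  { (inferInstance : AddCommGroup (Poly β)),
    (inferInstanceAs (NonUnitalNonAssocSemiring (⨁ n : G, β.Coeff n)) :
      NonUnitalNonAssocSemiring (Poly β)) with }

open scoped Classical in
theorem mono_mul_mono {n m : G} (f : β.Coeff n) (g : β.Coeff m) :
    mono n f * mono m g = mono (n + m) (mulCoeff n m f g) :=
  DirectSum.of_mul_of (A := fun n : G => β.Coeff n) f g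

theorem induction {p : Poly β → Prop} (F : Poly β) (h0 : p 0) (hm : ∀ n f, p (mono n f))
    (ha : ∀ F F', p F → p F' → p (F + F')) : p F := by
  classical
  exact DirectSum.induction_on F h0 hm ha

theorem mulCoeff_assoc {n m k : G} (f : β.Coeff n) (g : β.Coeff m) (h : β.Coeff k) (x : X) :
    (mulCoeff (n + m) k (mulCoeff n m f g) h).1 x =
      (mulCoeff n (m + k) f (mulCoeff m k g h)).1 x := by
  by_cases hn : x ∈ β.dom n
  · by_cases hnm : x ∈ β.dom (n + m)
    · rw [mulCoeff_of_mem _ _ hnm, mulCoeff_of_mem _ _ hn, mulCoeff_of_mem _ _ hn,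
        mulCoeff_of_mem _ _ ((β.symm_mem_iff hn).2 hnm), β.symm_symm hn hnm, mul_assoc]
    · rw [mulCoeff_of_notMem _ _ hnm, mulCoeff_of_mem _ _ hn,
        mulCoeff_of_notMem _ _ (fun h => hnm ((β.symm_mem_iff hn).1 h)), mul_zero]
  · rw [mulCoeff_of_notMem f _ hn]
    by_cases hnm : x ∈ β.dom (n + m)
    · rw [mulCoeff_of_mem _ _ hnm, mulCoeff_of_notMem _ _ hn, zero_mul]
    · rw [mulCoeff_of_notMem _ _ hnm]

instance : NonUnitalRing (Poly β) :=
  { (inferInstance : NonUnitalNonAssocRing (Poly β)) with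
    mul_assoc := by
      intro a b c
      induction a using Poly.induction with
      | h0 => simp
      | ha a a' h h' => simp only [add_mul, h, h']
      | hm n f =>
        induction b using Poly.induction with
        | h0 => simp
        | ha b b' h h' => simp only [add_mul, mul_add, h, h']
        | hm m g =>
          induction c using Poly.induction with
          | h0 => simp
          | ha c c' h h' => simp only [mul_add, h, h']
          | hm k h =>
            simp only [mono_mul_mono]
            exact mono_congr (add_assoc n m k) (mulCoeff_assoc f g h) }

theorem smul_mulCoeff {n m : G} (c : ℂ) (f : β.Coeff n) (g : β.Coeff m) :
    mulCoeff n m (c • f) g = c • mulCoeff n m f g := by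
  apply ideal_ext; intro x
  change _ = c * (mulCoeff n m f g).1 x
  by_cases hn : x ∈ β.dom n
  · simp [mulCoeff_of_mem _ _ hn, mul_assoc]
  · simp [mulCoeff_of_notMem _ _ hn]

theorem mulCoeff_smul {n m : G} (c : ℂ) (f : β.Coeff n) (g : β.Coeff m) :
    mulCoeff n m f (c • g) = c • mulCoeff n m f g := by
  apply ideal_ext; intro x
  change _ = c * (mulCoeff n m f g).1 x
  by_cases hn : x ∈ β.dom n
  · simp [mulCoeff_of_mem _ _ hn, mul_left_comm]
  · simp [mulCoeff_of_notMem _ _ hn]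

instance : IsScalarTower ℂ (Poly β) (Poly β) where
  smul_assoc c a b := by
    change (c • a) * b = c • (a * b)
    induction a using Poly.induction with
    | h0 => simp
    | ha a a' h h' => simp only [add_mul, smul_add, h, h']
    | hm n f =>
      induction b using Poly.induction with
      | h0 => simp
      | ha b b' h h' => simp only [mul_add, smul_add, h, h']
      | hm m g => simp only [← mono_smul, mono_mul_mono, smul_mulCoeff]

instance : SMulCommClass ℂ (Poly β) (Poly β) where
  smul_comm c a b := by
    change c • (a * b) = a * (c • b)
    induction a using Poly.induction with
    | h0 => simp
    | ha a a' h h' => simp only [add_mul, smul_add, h, h']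
    | hm n f =>
      induction b using Poly.induction with
      | h0 => simp
      | ha b b' h h' => simp only [mul_add, smul_add, h, h']
      | hm m g => simp only [← mono_smul, mono_mul_mono, mulCoeff_smul]

variable [T2Space X]

/-- `starCoeff` as an additive map. -/
def starCoeffHom (n : G) : β.Coeff n →+ β.Coeff (-n) where
  toFun := starCoeff n
  map_zero' := by
    apply ideal_ext; intro x
    change _ = (0 : ℂ)
    by_cases hn : x ∈ β.dom (-n)
    · simp [starCoeff_of_mem _ hn]
    · simp [starCoeff_of_notMem _ hn]
  map_add' f g := by
    apply ideal_ext; intro x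
    change _ = (starCoeff n f).1 x + (starCoeff n g).1 x
    by_cases hn : x ∈ β.dom (-n)
    · simp [starCoeff_of_mem _ hn]
    · simp [starCoeff_of_notMem _ hn]

open scoped Classical in
/-- The involution as an additive map. -/
def starHom : Poly β →+ Poly β :=
  DirectSum.toAddMonoid (β := fun n : G => β.Coeff n)
    fun n => (monoHom (-n)).comp (starCoeffHom n)

instance : Star (Poly β) := ⟨fun F => starHom F⟩

open scoped Classical in
theorem star_mono {n : G} (f : β.Coeff n) : star (mono n f) = mono (-n) (starCoeff n f) :=
  DirectSum.toAddMonoid_of (β := fun n : G => β.Coeff n)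
    (fun n => (monoHom (-n)).comp (starCoeffHom n)) n f

theorem star_add_aux (a b : Poly β) : star (a + b) = star a + star b := starHom.map_add a b

theorem star_zero_aux : star (0 : Poly β) = 0 := starHom.map_zero

theorem starCoeff_starCoeff {n : G} (f : β.Coeff n) (x : X) :
    (starCoeff (-n) (starCoeff n f)).1 x = f.1 x := by
  by_cases hn : x ∈ β.dom n
  · have hn' : x ∈ β.dom (- -n) := by rwa [neg_neg]
    rw [starCoeff_of_mem _ hn', starCoeff_of_mem _ (β.map_mem hn'), star_star]
    rw [← β.symm_eq hn, β.map_symm hn]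
  · rw [starCoeff_of_notMem _ (by rwa [neg_neg]), ideal_apply f hn]

theorem starCoeff_mulCoeff {n m : G} (f : β.Coeff n) (g : β.Coeff m) (x : X) :
    (starCoeff (n + m) (mulCoeff n m f g)).1 x =
      (mulCoeff (-m) (-n) (starCoeff m g) (starCoeff n f)).1 x := by
  by_cases h1 : x ∈ β.dom (-m)
  · rw [mulCoeff_of_mem _ _ h1, starCoeff_of_mem _ h1]
    have hs : (β.map (-m)).symm x = β.map m x := by rw [β.symm_eq h1, neg_neg]
    rw [hs]
    have hiff := β.symm_mem_iff (m := -n) h1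
    rw [hs] at hiff
    by_cases h2 : x ∈ β.dom (-m + -n)
    · have h3 : x ∈ β.dom (-(n + m)) := by rwa [neg_add_rev]
      have h4 := hiff.2 h2
      have h5 : β.map (n + m) x = β.map n (β.map m x) :=
        β.map_add n m x ⟨h1, by rwa [sub_eq_add_neg, add_comm]⟩
      rw [starCoeff_of_mem _ h3, starCoeff_of_mem _ h4, h5, mulCoeff_of_mem _ _ (β.map_mem h4),
        β.symm_map h4, star_mul]
    · rw [starCoeff_of_notMem _ (fun h => h2 (by rwa [← neg_add_rev])),
        starCoeff_of_notMem _ (fun h => h2 (hiff.1 h)), mul_zero]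
  · rw [mulCoeff_of_notMem _ _ h1]
    by_cases h3 : x ∈ β.dom (-(n + m))
    · rw [starCoeff_of_mem _ h3]
      by_cases h4 : β.map (n + m) x ∈ β.dom n
      · rw [mulCoeff_of_mem _ _ h4, ideal_apply g, mul_zero, star_zero]
        intro h5
        rw [β.symm_eq h4] at h5
        obtain ⟨y, hy, hy'⟩ := (β.image_inter_left (-n) (n + m)).superset
          ⟨by simpa using β.map_mem (t := -n) (by simpa using h4), by simpa using h5⟩
        have h6 : β.map (-n) (β.map (n + m) x) = β.map (-n + (n + m)) x := by
          rw [← β.map_add (-n) (n + m) x]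
          refine ⟨h3, ?_⟩
          have := (β.symm_mem_iff (n := n + m) (m := -n) (β.map_mem h3))
          have h7 := (β.image_inter_right (-n) (n + m)).superset
            ⟨β.map_mem h3, by simpa using h4⟩
          obtain ⟨z, hz, hz'⟩ := h7
          have : z = x := by rw [← β.symm_map hz.1, hz', β.symm_map h3]
          rw [← this]
          exact hz.2
        apply h1
        have h7 := (β.image_inter_right (-n) (n + m)).superset
            ⟨β.map_mem h3, by simpa using h4⟩
        obtain ⟨z, hz, hz'⟩ := h7
        have : z = x := by rw [← β.symm_map hz.1, hz', β.symm_map h3]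
        rw [← this]
        simpa using hz.2
      · rw [mulCoeff_of_notMem _ _ h4, star_zero]
    · rw [starCoeff_of_notMem _ h3]

instance : StarRing (Poly β) where
  star_involutive a := by
    induction a using Poly.induction with
    | h0 => simp only [star_zero_aux]
    | ha a a' h h' => simp only [star_add_aux, h, h']
    | hm n f =>
      rw [star_mono, star_mono]
      exact mono_congr (neg_neg n) (starCoeff_starCoeff f)
  star_add := star_add_aux
  star_mul a b := by
    induction a using Poly.induction with
    | h0 => simp [star_zero_aux]
    | ha a a' h h' => simp only [add_mul, mul_add, star_add_aux, h, h']
    | hm n f =>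
      induction b using Poly.induction with
      | h0 => simp [star_zero_aux]
      | ha b b' h h' => simp only [add_mul, mul_add, star_add_aux, h, h']
      | hm m g =>
        rw [mono_mul_mono, star_mono, star_mono, star_mono, mono_mul_mono]
        exact mono_congr (neg_add_rev n m) (starCoeff_mulCoeff f g)

instance : StarModule ℂ (Poly β) where
  star_smul c a := by
    induction a using Poly.induction with
    | h0 => simp
    | ha a a' h h' => simp only [smul_add, star_add, h, h']
    | hm n f =>
      rw [← mono_smul, star_mono, star_mono, ← mono_smul]
      congr 1
      apply ideal_ext; intro x
      change _ = star c * (starCoeff n f).1 x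
      by_cases hn : x ∈ β.dom (-n)
      · simp [starCoeff_of_mem _ hn]
      · simp [starCoeff_of_notMem _ hn]

/-- The norm `‖∑ f_n U^n‖_L = ∑ ‖f_n‖`. -/
def lnorm (F : Poly β) : ℝ := ∑ᶠ n, ‖(F.coeff n).1‖

end Poly

/-- A ⋆-representation of the polynomial algebra on a Hilbert space which is continuous with respect
to the `L`-norm. -/
structure Rep [T2Space X] (β : PartialAction G X) : Type (max u v + 1) where
  H : Type (max u v)
  [normedAddCommGroup : NormedAddCommGroup H]
  [innerProductSpace : InnerProductSpace ℂ H]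
  [completeSpace : CompleteSpace H]
  hom : Poly β →⋆ₙₐ[ℂ] (H →L[ℂ] H)
  continuous_lnorm : ∃ C : ℝ, ∀ F, ‖hom F‖ ≤ C * F.lnorm

attribute [instance] Rep.normedAddCommGroup Rep.innerProductSpace Rep.completeSpace

namespace Poly

variable [T2Space X]

/-- The C⋆-norm `‖F‖ = sup_π ‖π F‖`. -/
def cnorm (F : Poly β) : ℝ := ⨆ π : Rep β, ‖π.hom F‖

instance : Nonempty (Rep β) :=
  ⟨{ H := PUnit, hom := 0, continuous_lnorm := ⟨0, fun F => by simp⟩ }⟩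

/-- An element of `C₀(X)` as a coefficient in degree `0`. -/
def coeffZero (f : C₀(X, ℂ)) : β.Coeff 0 := ⟨f, fun x hx => absurd (by simp [β.dom_zero]) hx⟩

/-- The embedding of `C₀(X)` in degree `0`. -/
def zeroHom (β : PartialAction G X) : C₀(X, ℂ) →⋆ₙₐ[ℂ] Poly β where
  toFun f := mono 0 (coeffZero f)
  map_smul' c f := mono_smul 0 c (coeffZero f)
  map_zero' := (monoHom (β := β) 0).map_zero
  map_add' f g := (monoHom (β := β) 0).map_add (coeffZero f) (coeffZero g)
  map_mul' f g := by
    rw [mono_mul_mono]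
    refine mono_congr (add_zero 0).symm fun x => ?_
    rw [mulCoeff_of_mem _ _ (by simp [β.dom_zero]), β.symm_zero]
    rfl
  map_star' f := by
    rw [star_mono]
    refine mono_congr neg_zero.symm fun x => ?_
    rw [starCoeff_of_mem _ (by simp [β.dom_zero]), β.map_zero]
    rfl

theorem norm_hom_mono_le (π : Rep β) {n : G} (f : β.Coeff n) : ‖π.hom (mono n f)‖ ≤ ‖f.1‖ := by
  have h1 : star (mono n f) * mono n f =
      zeroHom β (mulCoeff (-n) n (starCoeff n f) f).1 := by
    rw [star_mono, mono_mul_mono]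
    exact mono_congr (neg_add_cancel n) fun x => rfl
  have h2 : ‖(mulCoeff (-n) n (starCoeff n f) f).1‖ ≤ ‖f.1‖ * ‖f.1‖ := by
    refine norm_le_of_forall (by positivity) fun x => ?_
    refine (norm_mulFun_le _ _ x).trans ?_
    gcongr
    change ‖starFun n f x‖ ≤ _
    by_cases hx : x ∈ β.dom (-n)
    · rw [starFun_of_mem f hx, norm_star]
      exact norm_apply_le_norm _ _
    · rw [starFun_of_notMem f hx, norm_zero]
      positivity
  have h3 : ‖π.hom (mono n f)‖ * ‖π.hom (mono n f)‖ ≤ ‖f.1‖ * ‖f.1‖ := by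
    rw [← CStarRing.norm_star_mul_self, ← map_star, ← map_mul, h1]
    exact (NonUnitalStarAlgHom.norm_apply_le (π.hom.comp (zeroHom β)) _).trans h2
  exact abs_le_of_sq_le_sq' (by nlinarith) (norm_nonneg _) |>.2

theorem bddAbove (F : Poly β) : BddAbove (Set.range fun π : Rep β => ‖π.hom F‖) := by
  suffices h : ∃ C : ℝ, ∀ π : Rep β, ‖π.hom F‖ ≤ C by
    obtain ⟨C, hC⟩ := h
    exact ⟨C, by rintro _ ⟨π, rfl⟩; exact hC π⟩
  induction F using Poly.induction with
  | h0 => exact ⟨0, fun π => by simp⟩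
  | hm n f => exact ⟨‖f.1‖, fun π => norm_hom_mono_le π f⟩
  | ha F F' h h' =>
    obtain ⟨C, hC⟩ := h
    obtain ⟨C', hC'⟩ := h'
    refine ⟨C + C', fun π => ?_⟩
    rw [_root_.map_add]
    exact (norm_add_le _ _).trans (add_le_add (hC π) (hC' π))

theorem norm_hom_le_cnorm (π : Rep β) (F : Poly β) : ‖π.hom F‖ ≤ cnorm F :=
  le_ciSup (bddAbove F) π

theorem cnorm_nonneg (F : Poly β) : 0 ≤ cnorm F := Real.iSup_nonneg fun _ => norm_nonneg _

theorem cnorm_le {F : Poly β} {C : ℝ} (h : ∀ π : Rep β, ‖π.hom F‖ ≤ C) : cnorm F ≤ C :=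
  ciSup_le h

/-- `cnorm` as a seminorm on the additive group of polynomials. -/
def cseminorm (β : PartialAction G X) : AddGroupSeminorm (Poly β) where
  toFun := cnorm
  map_zero' := le_antisymm (cnorm_le fun π => by simp) (cnorm_nonneg _)
  add_le' F F' := cnorm_le fun π => by
    rw [_root_.map_add]
    exact (norm_add_le _ _).trans (add_le_add (norm_hom_le_cnorm π F) (norm_hom_le_cnorm π F'))
  neg' F := by
    change (⨆ π : Rep β, ‖π.hom (-F)‖) = ⨆ π : Rep β, ‖π.hom F‖
    simp only [map_neg, norm_neg]

instance : SeminormedAddCommGroup (Poly β) := (cseminorm β).toSeminormedAddCommGroup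

theorem norm_def (F : Poly β) : ‖F‖ = cnorm F := rfl

instance : NonUnitalSeminormedRing (Poly β) :=
  { (inferInstance : SeminormedAddCommGroup (Poly β)),
    (inferInstance : NonUnitalRing (Poly β)) with
    norm_mul_le := fun F F' => cnorm_le fun π => by
      rw [map_mul]
      exact (norm_mul_le _ _).trans (mul_le_mul (norm_hom_le_cnorm π F) (norm_hom_le_cnorm π F')
        (norm_nonneg _) (cnorm_nonneg _)) }

instance : NormedSpace ℂ (Poly β) where
  norm_smul_le c F := cnorm_le fun π => by
    rw [map_smul]
    exact (norm_smul_le _ _).trans (mul_le_mul_of_nonneg_left (norm_hom_le_cnorm π F)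
      (norm_nonneg _))

instance : NormedStarGroup (Poly β) where
  norm_star_le F := cnorm_le fun π => by
    rw [map_star, norm_star]
    exact norm_hom_le_cnorm π F

theorem norm_mul_self_le (F : Poly β) : ‖F‖ * ‖F‖ ≤ ‖star F * F‖ := by
  have h : ‖F‖ ≤ √‖star F * F‖ := by
    refine cnorm_le fun π => Real.le_sqrt_of_sq_le ?_
    rw [sq, ← CStarRing.norm_star_mul_self, ← map_star, ← map_mul]
    exact norm_hom_le_cnorm π _
  calc ‖F‖ * ‖F‖ ≤ √‖star F * F‖ * √‖star F * F‖ := by gcongr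
    _ = ‖star F * F‖ := Real.mul_self_sqrt (norm_nonneg _)

end Poly

end Poly

section CrossedProduct

open UniformSpace

variable {G : Type v} [AddCommGroup G] {X : Type u} [TopologicalSpace X] [T2Space X]

/-- The partial crossed product `C₀(X) ×_β G`: the (Hausdorff) completion of the polynomial algebra
with respect to its C⋆-norm. -/
def CrossedProduct (β : PartialAction G X) : Type max u v := Completion (Poly β)

variable {β : PartialAction G X}

namespace CrossedProduct

instance : NormedAddCommGroup (CrossedProduct β) :=
  inferInstanceAs (NormedAddCommGroup (Completion (Poly β)))

instance : NormedSpace ℂ (CrossedProduct β) :=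
  inferInstanceAs (NormedSpace ℂ (Completion (Poly β)))

instance : CompleteSpace (CrossedProduct β) :=
  inferInstanceAs (CompleteSpace (Completion (Poly β)))

/-- The canonical map from polynomials to the crossed product. -/
def ofPoly (F : Poly β) : CrossedProduct β := (F : Completion (Poly β))

theorem isDenseInducing_ofPoly : IsDenseInducing (ofPoly : Poly β → CrossedProduct β) :=
  Completion.isDenseInducing_coe

theorem continuous_ofPoly : Continuous (ofPoly : Poly β → CrossedProduct β) :=
  Completion.continuous_coe _

theorem ofPoly_add (F F' : Poly β) : ofPoly (F + F') = ofPoly F + ofPoly F' :=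
  Completion.coe_add F F'

theorem ofPoly_zero : ofPoly (0 : Poly β) = 0 := rfl

theorem ofPoly_smul (c : ℂ) (F : Poly β) : ofPoly (c • F) = c • ofPoly F :=
  Completion.coe_smul c F

theorem norm_ofPoly (F : Poly β) : ‖ofPoly F‖ = ‖F‖ := Completion.norm_coe F

theorem induction_on {p : CrossedProduct β → Prop} (a : CrossedProduct β)
    (hp : IsClosed {a | p a}) (ih : ∀ F : Poly β, p (ofPoly F)) : p a :=
  Completion.induction_on a hp ih

/-- The continuous extension of the product of polynomials. -/
instance : Mul (CrossedProduct β) :=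
  ⟨Function.curry <| ((isDenseInducing_ofPoly (β := β)).prodMap
    (isDenseInducing_ofPoly (β := β))).extend (ofPoly ∘ Function.uncurry (· * ·))⟩

theorem ofPoly_mul (F F' : Poly β) : ofPoly (F * F') = ofPoly F * ofPoly F' :=
  (((isDenseInducing_ofPoly (β := β)).prodMap (isDenseInducing_ofPoly (β := β))).extend_eq
    (continuous_ofPoly.comp continuous_mul) (F, F')).symm

instance : ContinuousMul (CrossedProduct β) where
  continuous_mul := by
    let m := (AddMonoidHom.mul : Poly β →+ Poly β →+ Poly β).compr₂
      (Completion.toCompl : Poly β →+ Completion (Poly β))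
    have : Continuous fun p : Poly β × Poly β => m p.1 p.2 :=
      (Completion.continuous_coe (Poly β)).comp continuous_mul
    have di : IsDenseInducing (Completion.toCompl : Poly β → Completion (Poly β)) :=
      Completion.isDenseInducing_coe
    exact (di.extend_Z_bilin di this :)

/-- The continuous extension of the involution of polynomials. -/
instance : Star (CrossedProduct β) :=
  ⟨Completion.map (star : Poly β → Poly β)⟩

theorem continuous_star_aux : Continuous (star : CrossedProduct β → CrossedProduct β) :=
  Completion.continuous_map

theorem ofPoly_star (F : Poly β) : ofPoly (star F) = star (ofPoly F) :=
  (Completion.map_coe (starNormedAddGroupHom (E := Poly β)).uniformContinuous F).symm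

instance : ContinuousStar (CrossedProduct β) := ⟨continuous_star_aux⟩

theorem mul_assoc_aux (a b c : CrossedProduct β) : a * b * c = a * (b * c) := by
  induction a using induction_on with
  | hp => exact isClosed_eq (((continuous_id).mul (continuous_const)).mul (continuous_const)) ((continuous_id).mul ((continuous_const).mul (continuous_const)))
  | ih F =>
    induction b using induction_on with
    | hp => exact isClosed_eq (((continuous_const).mul (continuous_id)).mul (continuous_const)) ((continuous_const).mul ((continuous_id).mul (continuous_const)))
    | ih F' =>
      induction c using induction_on with
      | hp => exact isClosed_eq (((continuous_const).mul (continuous_const)).mul (continuous_id)) ((continuous_const).mul ((continuous_const).mul (continuous_id)))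
      | ih F'' => simp only [← ofPoly_mul, mul_assoc]

theorem mul_add_aux (a b c : CrossedProduct β) : a * (b + c) = a * b + a * c := by
  induction a using induction_on with
  | hp => exact isClosed_eq ((continuous_id).mul ((continuous_const).add (continuous_const))) (((continuous_id).mul (continuous_const)).add ((continuous_id).mul (continuous_const)))
  | ih F =>
    induction b using induction_on with
    | hp => exact isClosed_eq ((continuous_const).mul ((continuous_id).add (continuous_const))) (((continuous_const).mul (continuous_id)).add ((continuous_const).mul (continuous_const)))
    | ih F' =>
      induction c using induction_on with
      | hp => exact isClosed_eq ((continuous_const).mul ((continuous_const).add (continuous_id))) (((continuous_const).mul (continuous_const)).add ((continuous_const).mul (continuous_id)))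
      | ih F'' => simp only [← ofPoly_mul, ← ofPoly_add, mul_add]

theorem add_mul_aux (a b c : CrossedProduct β) : (a + b) * c = a * c + b * c := by
  induction a using induction_on with
  | hp => exact isClosed_eq (((continuous_id).add (continuous_const)).mul (continuous_const)) (((continuous_id).mul (continuous_const)).add ((continuous_const).mul (continuous_const)))
  | ih F =>
    induction b using induction_on with
    | hp => exact isClosed_eq (((continuous_const).add (continuous_id)).mul (continuous_const)) (((continuous_const).mul (continuous_const)).add ((continuous_id).mul (continuous_const)))
    | ih F' =>
      induction c using induction_on with
      | hp => exact isClosed_eq (((continuous_const).add (continuous_const)).mul (continuous_id)) (((continuous_const).mul (continuous_id)).add ((continuous_const).mul (continuous_id)))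
      | ih F'' => simp only [← ofPoly_mul, ← ofPoly_add, add_mul]

theorem zero_mul_aux (a : CrossedProduct β) : 0 * a = 0 := by
  induction a using induction_on with
  | hp => exact isClosed_eq (continuous_const.mul continuous_id) continuous_const
  | ih F => rw [← ofPoly_zero, ← ofPoly_mul, zero_mul]

theorem mul_zero_aux (a : CrossedProduct β) : a * 0 = 0 := by
  induction a using induction_on with
  | hp => exact isClosed_eq (continuous_id.mul continuous_const) continuous_const
  | ih F => rw [← ofPoly_zero, ← ofPoly_mul, mul_zero]

theorem norm_mul_le_aux (a b : CrossedProduct β) : ‖a * b‖ ≤ ‖a‖ * ‖b‖ := by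
  induction a using induction_on with
  | hp =>
    exact isClosed_le ((continuous_id.mul continuous_const).norm)
      (continuous_id.norm.mul continuous_const)
  | ih F =>
    induction b using induction_on with
    | hp =>
      exact isClosed_le ((continuous_const.mul continuous_id).norm)
        (continuous_const.mul continuous_id.norm)
    | ih F' =>
      simp only [← ofPoly_mul, norm_ofPoly]
      exact norm_mul_le F F'

instance : NonUnitalNormedRing (CrossedProduct β) :=
  { (inferInstance : NormedAddCommGroup (CrossedProduct β)),
    (inferInstance : Mul (CrossedProduct β)) with
    zero_mul := zero_mul_aux
    mul_zero := mul_zero_aux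
    mul_assoc := mul_assoc_aux
    left_distrib := mul_add_aux
    right_distrib := add_mul_aux
    norm_mul_le := norm_mul_le_aux }

instance : StarRing (CrossedProduct β) where
  star_involutive a := by
    induction a using induction_on with
    | hp => exact isClosed_eq continuous_id.star.star continuous_id
    | ih F => rw [← ofPoly_star, ← ofPoly_star, star_star]
  star_mul a b := by
    induction a using induction_on with
    | hp =>
      exact isClosed_eq (continuous_id.mul continuous_const).star
        (continuous_const.mul continuous_id.star)
    | ih F =>
      induction b using induction_on with
      | hp =>
        exact isClosed_eq (continuous_const.mul continuous_id).star
          (continuous_id.star.mul continuous_const)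
      | ih F' => simp only [← ofPoly_mul, ← ofPoly_star, star_mul]
  star_add a b := by
    induction a using induction_on with
    | hp =>
      exact isClosed_eq (continuous_id.add continuous_const).star
        (continuous_id.star.add continuous_const)
    | ih F =>
      induction b using induction_on with
      | hp =>
        exact isClosed_eq (continuous_const.add continuous_id).star
          (continuous_const.add continuous_id.star)
      | ih F' => simp only [← ofPoly_add, ← ofPoly_star, star_add]

instance : CStarRing (CrossedProduct β) where
  norm_mul_self_le a := by
    induction a using induction_on with
    | hp =>
      exact isClosed_le (continuous_id.norm.mul continuous_id.norm)
        (continuous_id.star.mul continuous_id).norm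
    | ih F =>
      simp only [← ofPoly_mul, ← ofPoly_star, norm_ofPoly]
      exact Poly.norm_mul_self_le F

instance : IsScalarTower ℂ (CrossedProduct β) (CrossedProduct β) where
  smul_assoc c a b := by
    change (c • a) * b = c • (a * b)
    induction a using induction_on with
    | hp =>
      exact isClosed_eq ((continuous_id.const_smul c).mul continuous_const)
        ((continuous_id.mul continuous_const).const_smul c)
    | ih F =>
      induction b using induction_on with
      | hp =>
        exact isClosed_eq (continuous_const.mul continuous_id)
          ((continuous_const.mul continuous_id).const_smul c)
      | ih F' => simp only [← ofPoly_mul, ← ofPoly_smul, smul_mul_assoc]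

instance : SMulCommClass ℂ (CrossedProduct β) (CrossedProduct β) where
  smul_comm c a b := by
    change c • (a * b) = a * (c • b)
    induction a using induction_on with
    | hp =>
      exact isClosed_eq ((continuous_id.mul continuous_const).const_smul c)
        (continuous_id.mul continuous_const)
    | ih F =>
      induction b using induction_on with
      | hp =>
        exact isClosed_eq ((continuous_const.mul continuous_id).const_smul c)
          (continuous_const.mul (continuous_id.const_smul c))
      | ih F' => simp only [← ofPoly_mul, ← ofPoly_smul, mul_smul_comm]

instance : StarModule ℂ (CrossedProduct β) where
  star_smul c a := by
    induction a using induction_on with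
    | hp =>
      exact isClosed_eq (continuous_id.const_smul c).star (continuous_id.star.const_smul (star c))
    | ih F => simp only [← ofPoly_star, ← ofPoly_smul, star_smul]

/-- The partial crossed product is a C⋆-algebra. -/
instance : NonUnitalCStarAlgebra (CrossedProduct β) where

/-- The monomial `f U^n` in the crossed product. -/
def mono (n : G) (f : β.Coeff n) : CrossedProduct β := ofPoly (Poly.mono n f)

/-- The canonical map from polynomials to the crossed product, as an algebra homomorphism. -/
def ofPolyHom (β : PartialAction G X) : Poly β →ₙₐ[ℂ] CrossedProduct β where
  toFun := ofPoly
  map_smul' := ofPoly_smul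
  map_zero' := ofPoly_zero
  map_add' := ofPoly_add
  map_mul' := ofPoly_mul

end CrossedProduct

end CrossedProduct

end PartialAction

/-- A positive cone in the abelian group `G`: a subset `Σ` with `Σ + Σ ⊆ Σ`, `Σ ∩ -Σ = {0}` (both
part of `AddGroupCone`) and `G = Σ - Σ`. -/
structure PositiveCone (G : Type v) [AddCommGroup G] extends AddGroupCone G where
  exists_eq_sub : ∀ g : G, ∃ s ∈ carrier, ∃ t ∈ carrier, g = s - t

namespace PartialAction

variable {G : Type v} [AddCommGroup G] {X : Type u} [TopologicalSpace X]

open scoped Classical in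
theorem Poly.coeff_mono_of_ne {β : PartialAction G X} {n m : G} (f : β.Coeff n) (h : n ≠ m) :
    (Poly.mono n f).coeff m = 0 := DirectSum.of_eq_of_ne (β := fun n : G => β.Coeff n) n m f h.symm

open scoped Classical in
theorem Poly.sum_coeff {β : PartialAction G X} (F : Poly β) :
    ∃ s : Finset G, (∑ n ∈ s, Poly.mono n (F.coeff n)) = F :=
  ⟨_, DirectSum.sum_support_of (β := fun n : G => β.Coeff n) F⟩

/-- Taking the coefficient of a polynomial, as an additive map. -/
def Poly.coeffHom (β : PartialAction G X) (k : G) : Poly β →+ β.Coeff k where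
  toFun F := F.coeff k
  map_zero' := rfl
  map_add' _ _ := rfl

/-- The polynomials `∑ f_n U^n` for which all `n` are in `Σ`. -/
def Poly.analytic (β : PartialAction G X) (S : PositiveCone G) :
    NonUnitalSubalgebra ℂ (Poly β) where
  carrier := {F | ∀ n ∉ S.carrier, F.coeff n = 0}
  add_mem' {F F'} hF hF' n hn := by
    change F.coeff n + F'.coeff n = 0
    rw [hF n hn, hF' n hn, add_zero]
  zero_mem' _ _ := rfl
  smul_mem' c F hF n hn := by
    change c • F.coeff n = 0
    rw [hF n hn, smul_zero]
  mul_mem' {F F'} hF hF' k hk := by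
    obtain ⟨s, hs⟩ := Poly.sum_coeff F
    obtain ⟨s', hs'⟩ := Poly.sum_coeff F'
    change Poly.coeffHom β k (F * F') = 0
    rw [← hs, ← hs', Finset.sum_mul_sum, map_sum]
    refine Finset.sum_eq_zero fun n _ => ?_
    rw [map_sum]
    refine Finset.sum_eq_zero fun m _ => ?_
    by_cases hn : n ∈ S.carrier
    · by_cases hm : m ∈ S.carrier
      · rw [Poly.mono_mul_mono]
        refine Poly.coeff_mono_of_ne _ ?_
        rintro rfl
        exact hk (S.add_mem' hn hm)
      · rw [hF' m hm, show Poly.mono m (0 : β.Coeff m) = 0 from (Poly.monoHom m).map_zero, mul_zero,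
          _root_.map_zero]
    · rw [hF n hn, show Poly.mono n (0 : β.Coeff n) = 0 from (Poly.monoHom n).map_zero, zero_mul,
        _root_.map_zero]

variable [T2Space X]

/-- The analytic crossed product `C₀(X) ×_β Σ`: the closure in `C₀(X) ×_β G` of the polynomials
`∑ f_n U^n` for which all `n` are in `Σ`. -/
def analytic (β : PartialAction G X) (S : PositiveCone G) :
    NonUnitalSubalgebra ℂ (CrossedProduct β) :=
  ((Poly.analytic β S).map (CrossedProduct.ofPolyHom β)).topologicalClosure

/-- `φ : Y → X` is a proper continuous surjection which intertwines the partial actions `γ` on `Y`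
and `β` on `X`. -/
structure IsProperIntertwiner {Y : Type w} [TopologicalSpace Y] (γ : PartialAction G Y)
    (β : PartialAction G X) (φ : Y → X) : Prop where
  continuous : Continuous φ
  surjective : Function.Surjective φ
  isCompact_preimage : ∀ K : Set X, IsCompact K → IsCompact (φ ⁻¹' K)
  mem_dom_iff : ∀ g y, φ y ∈ β.dom g ↔ y ∈ γ.dom g
  map_comm : ∀ g, ∀ y ∈ γ.dom (-g), β.map g (φ y) = φ (γ.map g y)

/-- `Φ : C₀(X) ×_β G → C₀(Y) ×_γ G` is given on monomials by `f U^n ↦ (f ∘ φ) V^n`. -/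
def IsInduced {Y : Type w} [TopologicalSpace Y] [T2Space Y] (γ : PartialAction G Y)
    (β : PartialAction G X) (φ : Y → X) (Φ : CrossedProduct β →⋆ₙₐ[ℂ] CrossedProduct γ) : Prop :=
  ∀ (n : G) (f : β.Coeff n), ∃ f' : γ.Coeff n, (∀ y, f'.1 y = f.1 (φ y)) ∧
    Φ (CrossedProduct.mono n f) = CrossedProduct.mono n f'

end PartialAction

instance {A : Type u} [NonUnitalNormedRing A] [NormedSpace ℂ A] (S : NonUnitalSubalgebra ℂ A) :
    NormedSpace ℂ S where
  norm_smul_le c a := norm_smul_le c (a : A)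

/-- The inverse limit of a sequence of spaces. -/
def InvLimit {X : ℕ → Type u} (φ : ∀ i, X (i + 1) → X i) : Set (∀ i, X i) :=
  {x | ∀ i, φ i (x (i + 1)) = x i}

/-- The canonical projection of the inverse limit onto `X i`. -/
def InvLimit.proj {X : ℕ → Type u} (φ : ∀ i, X (i + 1) → X i) (i : ℕ) (x : InvLimit φ) : X i :=
  x.1 i

/-- `B`, with the maps `Ψ i : A i → B`, is the direct limit of the sequence `(A i, Φ i)` in the
category of C⋆-algebras and ⋆-homomorphisms. -/
def IsCStarDirectLimit {A : ℕ → Type u} [∀ i, NonUnitalCStarAlgebra (A i)]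
    (Φ : ∀ i, A i →⋆ₙₐ[ℂ] A (i + 1)) {B : Type v} [NonUnitalCStarAlgebra B]
    (Ψ : ∀ i, A i →⋆ₙₐ[ℂ] B) : Prop :=
  (∀ i a, Ψ (i + 1) (Φ i a) = Ψ i a) ∧
  ∀ (C : Type w) [NonUnitalCStarAlgebra C] (ψ : ∀ i, A i →⋆ₙₐ[ℂ] C),
    (∀ i a, ψ (i + 1) (Φ i a) = ψ i a) → ∃! χ : B →⋆ₙₐ[ℂ] C, ∀ i a, χ (Ψ i a) = ψ i a

/-- `B`, with the maps `Ψ i : A i → B`, is the direct limit of the sequence `(A i, Φ i)` in the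
category of (complex) Banach algebras and contractive homomorphisms. -/
def IsBanachDirectLimit {A : ℕ → Type u} [∀ i, NonUnitalNormedRing (A i)]
    [∀ i, NormedSpace ℂ (A i)] (Φ : ∀ i, A i →ₙₐ[ℂ] A (i + 1)) {B : Type v}
    [NonUnitalNormedRing B] [NormedSpace ℂ B] (Ψ : ∀ i, A i →ₙₐ[ℂ] B) : Prop :=
  (∀ i, CompleteSpace (A i)) ∧ CompleteSpace B ∧
  (∀ i a, ‖Φ i a‖ ≤ ‖a‖) ∧ (∀ i a, ‖Ψ i a‖ ≤ ‖a‖) ∧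
  (∀ i a, Ψ (i + 1) (Φ i a) = Ψ i a) ∧
  ∀ (C : Type w) [NonUnitalNormedRing C] [NormedSpace ℂ C] [IsScalarTower ℂ C C]
    [SMulCommClass ℂ C C] [CompleteSpace C] (ψ : ∀ i, A i →ₙₐ[ℂ] C),
    (∀ i a, ‖ψ i a‖ ≤ ‖a‖) → (∀ i a, ψ (i + 1) (Φ i a) = ψ i a) →
      ∃! χ : B →ₙₐ[ℂ] C, (∀ b, ‖χ b‖ ≤ ‖b‖) ∧ ∀ i a, χ (Ψ i a) = ψ i a

end

/-!
A polynomial `∑ f_n U^n` over `X` pulls back along a proper intertwiner `φ : Y → X` to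
`∑ (f_n ∘ φ) U^n`. Representations of the polynomials over `Y` thereby become representations of the
polynomials over `X`, so this pullback is contractive and extends to the crossed products.

**Injectivity.** The compact group of characters of `G` acts on every crossed product by
`τ_χ (f U^n) = χ(n) f U^n`. Averaging over this action with respect to Haar measure gives the
conditional expectation `∑ f_n U^n ↦ f_0` onto `C₀(X)` (`expectation_mem_range`). It is faithful on
elements `a⋆ a`: in each representation, `χ ↦ ‖π (τ_χ a) ξ‖²` is continuous and nonnegative, so it
vanishes identically if its integral does (`eq_zero_of_expectation`). The pullback `Φ` commutes with
the characters, hence with the expectation. If `Φ a = 0`, the coefficient `f` with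
`f = E (a⋆ a)` satisfies `f ∘ φ = 0` in the crossed product over `Y`, where `C₀(Y)` embeds because of
the regular representations on `ℓ²(G)` along orbits (`apply_eq_zero_of_mono_eq_zero`). So `f = 0` as
`φ` is surjective, and `a = 0` by faithfulness (`injective_twistedPullback_one`). This makes `Φ`
isometric.

**Direct limits.** On the inverse limit the partial action is taken coordinatewise, and the
projections are proper because preimages of compact sets are closed in products of compact sets. By
Urysohn's lemma and the Stone-Weierstrass theorem, every coefficient on the limit is a uniform limit
of coefficients pulled back from the `X i` *with the same exponent* (`exists_pullback_near`). The
isometric images of the crossed products over the `X i`, and of their analytic subalgebras, thus have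
dense union, and compatible contractive homomorphisms on such a sequence extend uniquely to the
limit (`exists_contractive_hom`). For C⋆-algebras contractivity is automatic.
-/

noncomputable section

/-! ### Extending ⋆-homomorphisms from polynomials to crossed products -/

namespace PartialAction

section Lift

variable {G : Type v} [AddCommGroup G] {X : Type u} [TopologicalSpace X] [T2Space X]
  {β : PartialAction G X}

open scoped Classical in
/-- The ⋆-homomorphism on polynomials determined by its values on monomials. -/
def Poly.lift {A : Type*} [NonUnitalRing A] [Module ℂ A] [StarRing A]
    (θ : ∀ n, β.Coeff n →ₗ[ℂ] A)
    (hmul : ∀ n m f g, θ (n + m) (mulCoeff n m f g) = θ n f * θ m g)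
    (hstar : ∀ n f, θ (-n) (starCoeff n f) = star (θ n f)) : Poly β →⋆ₙₐ[ℂ] A :=
  let L : Poly β →ₗ[ℂ] A := DirectSum.toModule ℂ G A θ
  have hL (n : G) (f : β.Coeff n) : L (Poly.mono n f) = θ n f :=
    DirectSum.toModule_lof (M := fun n : G => β.Coeff n) ℂ n f
  { toFun := L
    map_smul' := L.map_smul
    map_zero' := L.map_zero
    map_add' := L.map_add
    map_mul' := fun F F' => by
      induction F using Poly.induction with
      | h0 => simp
      | ha a a' h h' => simp only [add_mul, _root_.map_add, h, h']
      | hm n f =>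
        induction F' using Poly.induction with
        | h0 => simp
        | ha b b' h h' => simp only [mul_add, _root_.map_add, h, h']
        | hm m g => rw [Poly.mono_mul_mono, hL, hL, hL, hmul]
    map_star' := fun F => by
      induction F using Poly.induction with
      | h0 => simp
      | ha a a' h h' => simp only [star_add, _root_.map_add, h, h']
      | hm n f => rw [Poly.star_mono, hL, hL, hstar] }

open scoped Classical in
theorem Poly.lift_mono {A : Type*} [NonUnitalRing A] [Module ℂ A] [StarRing A]
    (θ : ∀ n, β.Coeff n →ₗ[ℂ] A)
    (hmul : ∀ n m f g, θ (n + m) (mulCoeff n m f g) = θ n f * θ m g)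
    (hstar : ∀ n f, θ (-n) (starCoeff n f) = star (θ n f)) (n : G) (f : β.Coeff n) :
    Poly.lift θ hmul hstar (Poly.mono n f) = θ n f :=
  DirectSum.toModule_lof (M := fun n : G => β.Coeff n) ℂ n f

/-- The C⋆-identity in degree `0` bounds every ⋆-representation on monomials; no continuity
assumption is needed. -/
theorem Poly.norm_apply_mono_le {A : Type*} [NonUnitalCStarAlgebra A] (π : Poly β →⋆ₙₐ[ℂ] A)
    {n : G} (f : β.Coeff n) : ‖π (Poly.mono n f)‖ ≤ ‖f.1‖ := by
  have h1 : star (Poly.mono n f) * Poly.mono n f =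
      Poly.zeroHom β (mulCoeff (-n) n (starCoeff n f) f).1 := by
    rw [Poly.star_mono, Poly.mono_mul_mono]
    exact Poly.mono_congr (neg_add_cancel n) fun x => rfl
  have h2 : ‖(mulCoeff (-n) n (starCoeff n f) f).1‖ ≤ ‖f.1‖ * ‖f.1‖ := by
    refine norm_le_of_forall (by positivity) fun x => ?_
    refine (norm_mulFun_le _ _ x).trans ?_
    gcongr
    change ‖starFun n f x‖ ≤ _
    by_cases hx : x ∈ β.dom (-n)
    · rw [starFun_of_mem f hx, norm_star]
      exact norm_apply_le_norm _ _
    · rw [starFun_of_notMem f hx, norm_zero]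
      positivity
  have h3 : ‖π (Poly.mono n f)‖ * ‖π (Poly.mono n f)‖ ≤ ‖f.1‖ * ‖f.1‖ := by
    rw [← CStarRing.norm_star_mul_self, ← map_star, ← map_mul, h1]
    exact (NonUnitalStarAlgHom.norm_apply_le (π.comp (Poly.zeroHom β)) _).trans h2
  exact abs_le_of_sq_le_sq' (by nlinarith) (norm_nonneg _) |>.2

open scoped Classical in
theorem Poly.norm_apply_le_lnorm {A : Type*} [NonUnitalCStarAlgebra A] (π : Poly β →⋆ₙₐ[ℂ] A)
    (F : Poly β) : ‖π F‖ ≤ F.lnorm := by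
  let F' : ⨁ n : G, β.Coeff n := F
  have hF : (∑ n ∈ DFinsupp.support F', Poly.mono n (F.coeff n)) = F :=
    DirectSum.sum_support_of (β := fun n : G => β.Coeff n) F
  have hl : F.lnorm = ∑ n ∈ DFinsupp.support F', ‖(F.coeff n).1‖ := by
    refine finsum_eq_sum_of_support_subset _ fun n hn => ?_
    rw [Finset.mem_coe, DFinsupp.mem_support_iff]
    rintro h
    apply hn
    change ‖(F' n).1‖ = 0
    rw [h, zero_val, norm_zero]
  rw [hl]
  nth_rw 1 [← hF]
  rw [map_sum]
  exact norm_sum_le_of_le _ fun n _ => Poly.norm_apply_mono_le π _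

/-- A ⋆-homomorphism from polynomials to operators on a Hilbert space, as a representation. -/
def Rep.mk' {H : Type (max u v)} [NormedAddCommGroup H] [InnerProductSpace ℂ H] [CompleteSpace H]
    (π : Poly β →⋆ₙₐ[ℂ] (H →L[ℂ] H)) : Rep β where
  H := H
  hom := π
  continuous_lnorm := ⟨1, fun F => by rw [one_mul]; exact Poly.norm_apply_le_lnorm π F⟩

theorem Poly.norm_apply_le_norm {H : Type (max u v)} [NormedAddCommGroup H]
    [InnerProductSpace ℂ H] [CompleteSpace H] (π : Poly β →⋆ₙₐ[ℂ] (H →L[ℂ] H)) (F : Poly β) :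
    ‖π F‖ ≤ ‖F‖ :=
  Poly.norm_hom_le_cnorm (Rep.mk' π) F

/-- ⋆-homomorphisms between polynomial algebras are contractive, as representations pull back. -/
theorem Poly.norm_map_le {Y : Type u} [TopologicalSpace Y] [T2Space Y] {γ : PartialAction G Y}
    (T : Poly β →⋆ₙₐ[ℂ] Poly γ) (F : Poly β) : ‖T F‖ ≤ ‖F‖ :=
  Poly.cnorm_le fun π => Poly.norm_apply_le_norm (π.hom.comp T) F

namespace CrossedProduct

theorem denseRange_ofPoly : DenseRange (ofPoly : Poly β → CrossedProduct β) :=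
  UniformSpace.Completion.denseRange_coe

/-- The extension of a contractive ⋆-homomorphism from polynomials to the crossed product. -/
def lift {A : Type*} [NonUnitalCStarAlgebra A] (T : Poly β →⋆ₙₐ[ℂ] A) (hT : ∀ F, ‖T F‖ ≤ ‖F‖) :
    CrossedProduct β →⋆ₙₐ[ℂ] A :=
  let T' : Poly β →ₗ[ℂ] A := ⟨⟨T, _root_.map_add T⟩, map_smul T⟩
  let i : Poly β →ₗ[ℂ] CrossedProduct β := ⟨⟨ofPoly, ofPoly_add⟩, ofPoly_smul⟩
  let E : CrossedProduct β →L[ℂ] A := T'.extendOfNorm i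
  have hE (F : Poly β) : E (ofPoly F) = T F :=
    LinearMap.extendOfNorm_eq (f := T') (e := i) denseRange_ofPoly
      ⟨1, fun F => by rw [one_mul]; exact (hT F).trans_eq (norm_ofPoly F).symm⟩ F
  { toFun := E
    map_smul' := E.map_smul
    map_zero' := E.map_zero
    map_add' := E.map_add
    map_mul' := fun a b => by
      change E (a * b) = E a * E b
      induction a using induction_on with
      | hp =>
        exact isClosed_eq (E.continuous.comp (continuous_id.mul continuous_const))
          ((E.continuous.comp continuous_id).mul continuous_const)
      | ih F =>
        induction b using induction_on with
        | hp =>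
          exact isClosed_eq (E.continuous.comp (continuous_const.mul continuous_id))
            (continuous_const.mul (E.continuous.comp continuous_id))
        | ih F' => rw [← ofPoly_mul, hE, hE, hE, map_mul]
    map_star' := fun a => by
      induction a using induction_on with
      | hp =>
        exact isClosed_eq (E.continuous.comp continuous_star) (continuous_star.comp E.continuous)
      | ih F => rw [← ofPoly_star, hE, hE, map_star] }

theorem lift_ofPoly {A : Type*} [NonUnitalCStarAlgebra A] (T : Poly β →⋆ₙₐ[ℂ] A)
    (hT : ∀ F, ‖T F‖ ≤ ‖F‖) (F : Poly β) : lift T hT (ofPoly F) = T F :=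
  LinearMap.extendOfNorm_eq (f := (⟨⟨T, _root_.map_add T⟩, map_smul T⟩ : Poly β →ₗ[ℂ] A))
    (e := (⟨⟨ofPoly, ofPoly_add⟩, ofPoly_smul⟩ : Poly β →ₗ[ℂ] CrossedProduct β)) denseRange_ofPoly
    ⟨1, fun F => by rw [one_mul]; exact (hT F).trans_eq (norm_ofPoly F).symm⟩ F

theorem continuous_hom {A : Type*} [NonUnitalCStarAlgebra A] (Φ : CrossedProduct β →⋆ₙₐ[ℂ] A) :
    Continuous Φ :=
  (AddMonoidHomClass.lipschitz_of_bound Φ 1 fun a => by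
    rw [one_mul]; exact NonUnitalStarAlgHom.norm_apply_le Φ a).continuous

theorem hom_ext {A : Type*} [NonUnitalCStarAlgebra A] {Φ Φ' : CrossedProduct β →⋆ₙₐ[ℂ] A}
    (h : ∀ n f, Φ (mono n f) = Φ' (mono n f)) : Φ = Φ' := by
  ext a
  induction a using induction_on with
  | hp => exact isClosed_eq (continuous_hom Φ) (continuous_hom Φ')
  | ih F =>
    induction F using Poly.induction with
    | h0 => simp [ofPoly_zero]
    | hm n f => exact h n f
    | ha F F' hF hF' => rw [ofPoly_add, _root_.map_add, _root_.map_add, hF, hF']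

/-- The homomorphism of crossed products induced by a ⋆-homomorphism of polynomial algebras. -/
def map {Y : Type u} [TopologicalSpace Y] [T2Space Y] {γ : PartialAction G Y}
    (T : Poly β →⋆ₙₐ[ℂ] Poly γ) : CrossedProduct β →⋆ₙₐ[ℂ] CrossedProduct γ :=
  lift
    { ofPolyHom γ with
      toFun := fun F => ofPoly (T F)
      map_smul' := fun c F => by rw [map_smul, ofPoly_smul]; rfl
      map_zero' := by rw [_root_.map_zero, ofPoly_zero]
      map_add' := fun F F' => by rw [_root_.map_add, ofPoly_add]
      map_mul' := fun F F' => by rw [map_mul, ofPoly_mul]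
      map_star' := fun F => by rw [map_star, ofPoly_star] }
    fun F => (norm_ofPoly _).trans_le (Poly.norm_map_le T F)

theorem map_ofPoly {Y : Type u} [TopologicalSpace Y] [T2Space Y] {γ : PartialAction G Y}
    (T : Poly β →⋆ₙₐ[ℂ] Poly γ) (F : Poly β) : map T (ofPoly F) = ofPoly (T F) :=
  lift_ofPoly _ _ F

/-- The extension of a representation to the crossed product. -/
def ofRep (π : Rep β) : CrossedProduct β →⋆ₙₐ[ℂ] (π.H →L[ℂ] π.H) :=
  lift π.hom (Poly.norm_hom_le_cnorm π)

theorem ofRep_ofPoly (π : Rep β) (F : Poly β) : ofRep π (ofPoly F) = π.hom F := lift_ofPoly _ _ F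

/-- The representations are jointly faithful on the completion. -/
theorem eq_zero_of_ofRep {a : CrossedProduct β} (h : ∀ π, ofRep π a = 0) : a = 0 := by
  rw [← norm_le_zero_iff]
  refine le_of_forall_pos_le_add fun ε hε => ?_
  obtain ⟨F, hF⟩ := Metric.denseRange_iff.1 (denseRange_ofPoly (β := β)) a (ε / 2) (half_pos hε)
  rw [dist_eq_norm] at hF
  have h1 : ‖ofPoly F‖ ≤ ε / 2 := by
    rw [norm_ofPoly]
    refine Poly.cnorm_le fun π => ?_
    have := NonUnitalStarAlgHom.norm_apply_le (ofRep π) (a - ofPoly F)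
    rw [map_sub, h, zero_sub, norm_neg, ofRep_ofPoly] at this
    exact this.trans hF.le
  have h2 : ‖a‖ ≤ ‖a - ofPoly F‖ + ‖ofPoly F‖ := by
    simpa using norm_add_le (a - ofPoly F) (ofPoly F)
  linarith

end CrossedProduct

end Lift

end PartialAction

/-! ### Characters and pullbacks -/

namespace PartialAction

section Pullback

variable {G : Type v} [AddCommGroup G]

/-- The characters of the discrete group `G`, as a (closed) subgroup of the compact group
`G → Circle`. Its topology is that of pointwise convergence. -/
def characters (G : Type v) [AddCommGroup G] : Subgroup (G → Circle) where
  carrier := {χ | ∀ m n, χ (m + n) = χ m * χ n}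
  mul_mem' {χ ψ} hχ hψ m n := by
    rw [Pi.mul_apply, hχ, hψ, Pi.mul_apply, Pi.mul_apply, mul_mul_mul_comm]
  one_mem' m n := by simp
  inv_mem' {χ} hχ m n := by
    rw [Pi.inv_apply, hχ, mul_inv, Pi.inv_apply, Pi.inv_apply]

namespace characters

theorem map_add (χ : characters G) (m n : G) : χ.1 (m + n) = χ.1 m * χ.1 n := χ.2 m n

theorem map_zero (χ : characters G) : χ.1 0 = 1 := by
  have := map_add χ 0 0
  rwa [add_zero, left_eq_mul] at this

theorem map_neg (χ : characters G) (n : G) : χ.1 (-n) = (χ.1 n)⁻¹ := by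
  rw [eq_inv_iff_mul_eq_one, ← map_add, neg_add_cancel, map_zero]

instance : CompactSpace (characters G) := by
  refine isCompact_iff_compactSpace.1 (IsClosed.isCompact ?_)
  have : ((characters G : Subgroup (G → Circle)) : Set (G → Circle)) =
      ⋂ m, ⋂ n, {χ | χ (m + n) = χ m * χ n} := by
    ext χ
    simp only [Set.mem_iInter]
    rfl
  rw [this]
  exact isClosed_iInter fun m => isClosed_iInter fun n =>
    isClosed_eq (continuous_apply _) (by fun_prop)

theorem continuous_eval (n : G) : Continuous fun χ : characters G => ((χ.1 n : Circle) : ℂ) :=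
  continuous_subtype_val.comp ((continuous_apply n).comp continuous_subtype_val)

/-- Characters separate the points of `G`, since the divisible group `ℚ/ℤ` is injective. -/
theorem exists_ne_one {n : G} (hn : n ≠ 0) : ∃ χ : characters G, χ.1 n ≠ 1 := by
  obtain ⟨c, hc⟩ := CharacterModule.exists_character_apply_ne_zero_of_ne_zero hn
  -- The embedding of `ℚ/ℤ` in the circle, induced by `q ↦ exp (2πiq)`.
  let e : ℚ →+ Additive Circle :=
    { toFun := fun q => Additive.ofMul (Circle.exp (2 * Real.pi * q))
      map_zero' := by simp
      map_add' := fun p q => by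
        rw [← ofMul_mul, ← Circle.exp_add]
        push_cast
        ring_nf }
  let e' : AddCircle (1 : ℚ) →+ Additive Circle :=
    QuotientAddGroup.lift (AddSubgroup.zmultiples (1 : ℚ)) e (by
      rintro _ ⟨k, rfl⟩
      change Additive.ofMul (Circle.exp (2 * Real.pi * ((k • (1 : ℚ) : ℚ) : ℝ))) = 0
      rw [ofMul_eq_zero, Circle.exp_eq_one]
      exact ⟨k, by push_cast [zsmul_eq_mul]; ring⟩)
  let c' : G →+ AddCircle (1 : ℚ) := c
  refine ⟨⟨fun g => (e' (c' g)).toMul, fun m k => ?_⟩, fun h => hc ?_⟩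
  · change (e' (c' (m + k))).toMul = (e' (c' m)).toMul * (e' (c' k)).toMul
    rw [_root_.map_add, _root_.map_add, toMul_add]
  · change c' n = 0
    change (e' (c' n)).toMul = 1 at h
    obtain ⟨q, hq⟩ := QuotientAddGroup.mk_surjective (c' n)
    rw [← hq] at h ⊢
    have h' : Circle.exp (2 * Real.pi * q) = 1 := h
    rw [Circle.exp_eq_one] at h'
    obtain ⟨k, hk⟩ := h'
    rw [QuotientAddGroup.eq_zero_iff, AddSubgroup.mem_zmultiples_iff]
    refine ⟨k, ?_⟩
    have : (q : ℝ) = k := by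
      have h2 : (2 * Real.pi) ≠ 0 := by positivity
      have : 2 * Real.pi * q = 2 * Real.pi * k := by rw [hk]; ring
      exact mul_left_cancel₀ h2 this
    rw [zsmul_eq_mul, mul_one]
    exact_mod_cast this.symm

end characters

variable {X : Type u} [TopologicalSpace X] {Y : Type u} [TopologicalSpace Y]
  {β : PartialAction G X} {γ : PartialAction G Y} {φ : Y → X}

theorem IsProperIntertwiner.tendsto_cocompact (h : IsProperIntertwiner γ β φ) :
    Tendsto φ (cocompact Y) (cocompact X) := by
  rw [hasBasis_cocompact.tendsto_iff hasBasis_cocompact]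
  exact fun K hK => ⟨φ ⁻¹' K, h.isCompact_preimage K hK, fun y hy => hy⟩

/-- Intertwiners also commute with the inverse maps `β_n⁻¹`, in terms of which products are
defined. -/
theorem IsProperIntertwiner.symm_comm (h : IsProperIntertwiner γ β φ) {n : G} {y : Y}
    (hy : y ∈ γ.dom n) : (β.map n).symm (φ y) = φ ((γ.map n).symm y) := by
  rw [γ.symm_eq hy, β.symm_eq ((h.mem_dom_iff n y).2 hy)]
  exact h.map_comm (-n) y (by rwa [neg_neg])

theorem isProperIntertwiner_id (β : PartialAction G X) : IsProperIntertwiner β β id :=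
  ⟨continuous_id, Function.surjective_id, fun _ hK => hK, fun _ _ => Iff.rfl, fun _ _ _ => rfl⟩

/-- The pullback `f ↦ f ∘ φ` of coefficients along a proper intertwiner. -/
def pullback (h : IsProperIntertwiner γ β φ) (n : G) : β.Coeff n →ₗ[ℂ] γ.Coeff n where
  toFun f := ⟨f.1.comp ⟨⟨φ, h.continuous⟩, h.tendsto_cocompact⟩,
    fun y hy => f.2 _ fun hy' => hy ((h.mem_dom_iff n y).1 hy')⟩
  map_add' _ _ := rfl
  map_smul' _ _ := rfl

theorem pullback_apply (h : IsProperIntertwiner γ β φ) {n : G} (f : β.Coeff n) (y : Y) :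
    (pullback h n f).1 y = f.1 (φ y) := rfl

theorem pullback_mulCoeff (h : IsProperIntertwiner γ β φ) {n m : G} (f : β.Coeff n)
    (g : β.Coeff m) :
    pullback h (n + m) (mulCoeff n m f g) = mulCoeff n m (pullback h n f) (pullback h m g) := by
  refine ideal_ext fun y => ?_
  rw [pullback_apply]
  by_cases hy : y ∈ γ.dom n
  · rw [mulCoeff_of_mem _ _ hy, mulCoeff_of_mem _ _ ((h.mem_dom_iff n y).2 hy), h.symm_comm hy]
    rfl
  · rw [mulCoeff_of_notMem _ _ hy, mulCoeff_of_notMem _ _ fun hy' => hy ((h.mem_dom_iff n y).1 hy')]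

variable [T2Space X] [T2Space Y]

theorem pullback_starCoeff (h : IsProperIntertwiner γ β φ) {n : G} (f : β.Coeff n) :
    pullback h (-n) (starCoeff n f) = starCoeff n (pullback h n f) := by
  refine ideal_ext fun y => ?_
  rw [pullback_apply]
  by_cases hy : y ∈ γ.dom (-n)
  · rw [starCoeff_of_mem _ hy, starCoeff_of_mem _ ((h.mem_dom_iff _ y).2 hy), h.map_comm n y hy]
    rfl
  · rw [starCoeff_of_notMem _ hy, starCoeff_of_notMem _ fun hy' => hy ((h.mem_dom_iff _ y).1 hy')]

/-- The ⋆-homomorphism `f U^n ↦ χ(n) (f ∘ φ) U^n` for a character `χ` and a proper intertwiner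
`φ`. -/
def Poly.twistedPullback (h : IsProperIntertwiner γ β φ) (χ : characters G) :
    Poly β →⋆ₙₐ[ℂ] Poly γ :=
  Poly.lift
    (fun n =>
      { toFun := fun f => Poly.mono n (((χ.1 n : Circle) : ℂ) • pullback h n f)
        map_add' := fun f g => by
          rw [_root_.map_add, smul_add]
          exact (Poly.monoHom n).map_add _ _
        map_smul' := fun c f => by
          rw [_root_.map_smul, smul_comm, Poly.mono_smul n c, RingHom.id_apply] })
    (fun n m f g => by
      change Poly.mono _ _ = Poly.mono _ _ * Poly.mono _ _
      rw [Poly.mono_mul_mono, Poly.smul_mulCoeff, Poly.mulCoeff_smul, smul_smul,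
        pullback_mulCoeff, characters.map_add, Circle.coe_mul])
    (fun n f => by
      change Poly.mono _ _ = star (Poly.mono _ _)
      rw [Poly.mono_smul, Poly.mono_smul, star_smul, Poly.star_mono, pullback_starCoeff,
        characters.map_neg, Circle.coe_inv_eq_conj]
      rfl)

theorem Poly.twistedPullback_mono (h : IsProperIntertwiner γ β φ) (χ : characters G) (n : G)
    (f : β.Coeff n) : Poly.twistedPullback h χ (Poly.mono n f) =
      ((χ.1 n : Circle) : ℂ) • Poly.mono n (pullback h n f) :=
  (Poly.lift_mono _ _ _ n f).trans (Poly.mono_smul _ _ _)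

namespace CrossedProduct

/-- The homomorphism of crossed products with `f U^n ↦ χ(n) (f ∘ φ) U^n`. -/
def twistedPullback (h : IsProperIntertwiner γ β φ) (χ : characters G) :
    CrossedProduct β →⋆ₙₐ[ℂ] CrossedProduct γ :=
  map (Poly.twistedPullback h χ)

theorem twistedPullback_mono (h : IsProperIntertwiner γ β φ) (χ : characters G) (n : G)
    (f : β.Coeff n) : twistedPullback h χ (mono n f) =
      ((χ.1 n : Circle) : ℂ) • mono n (pullback h n f) := by
  rw [twistedPullback, mono, map_ofPoly, Poly.twistedPullback_mono, ofPoly_smul, mono]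

theorem twistedPullback_one_mono (h : IsProperIntertwiner γ β φ) (n : G) (f : β.Coeff n) :
    twistedPullback h 1 (mono n f) = mono n (pullback h n f) := by
  rw [twistedPullback_mono]
  simp

end CrossedProduct

/-- Being induced by `φ` determines the homomorphism, as monomials span a dense subspace. -/
theorem isInduced_iff (h : IsProperIntertwiner γ β φ)
    (Φ : CrossedProduct β →⋆ₙₐ[ℂ] CrossedProduct γ) :
    IsInduced γ β φ Φ ↔ Φ = CrossedProduct.twistedPullback h 1 := by
  refine ⟨fun hΦ => CrossedProduct.hom_ext fun n f => ?_, ?_⟩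
  · obtain ⟨f', hf', e⟩ := hΦ n f
    rw [e, CrossedProduct.twistedPullback_one_mono, ideal_ext (g := pullback h n f) hf']
  · rintro rfl n f
    exact ⟨pullback h n f, fun y => rfl, CrossedProduct.twistedPullback_one_mono h n f⟩

end Pullback

/-! ### The regular representations -/

section Regular

/-- The weighted shift `(T ξ)(k) = a k * ξ (σ k)` on `ℓ²`. -/
def weightedShift {ι : Type*} (σ : ι ≃ ι) (a : ι → ℂ) (C : ℝ) (ha : ∀ k, ‖a k‖ ≤ C) :
    lp (fun _ : ι => ℂ) 2 →L[ℂ] lp (fun _ : ι => ℂ) 2 :=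
  have hs (ξ : lp (fun _ : ι => ℂ) 2) (k : ι) :
      ‖a k * ξ (σ k)‖ ^ (2 : ENNReal).toReal ≤ C ^ 2 * ‖ξ (σ k)‖ ^ (2 : ENNReal).toReal := by
    simp only [ENNReal.toReal_ofNat, Real.rpow_ofNat, norm_mul, mul_pow]
    gcongr
    exact ha k
  have hsum (ξ : lp (fun _ : ι => ℂ) 2) :
      HasSum (fun k => C ^ 2 * ‖ξ (σ k)‖ ^ (2 : ENNReal).toReal)
        (C ^ 2 * ‖ξ‖ ^ (2 : ENNReal).toReal) :=
    (σ.hasSum_iff.2 (lp.hasSum_norm (by simp) ξ)).mul_left _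
  have hm (ξ : lp (fun _ : ι => ℂ) 2) : Memℓp (fun k => a k * ξ (σ k)) 2 :=
    memℓp_gen (Summable.of_nonneg_of_le (fun k => by positivity) (hs ξ) (hsum ξ).summable)
  LinearMap.mkContinuous
    { toFun := fun ξ => ⟨fun k => a k * ξ (σ k), hm ξ⟩
      map_add' := fun ξ η => by
        ext k
        exact mul_add _ _ _
      map_smul' := fun c ξ => by
        ext k
        exact mul_left_comm _ _ _ }
    |C| fun ξ => by
      refine lp.norm_le_of_forall_sum_le (by simp) (by positivity) fun s => ?_
      refine (Finset.sum_le_sum fun k _ => hs ξ k).trans ?_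
      refine (sum_le_hasSum s (fun k _ => by positivity) (hsum ξ)).trans_eq ?_
      simp [mul_pow]

theorem weightedShift_apply {ι : Type*} (σ : ι ≃ ι) (a : ι → ℂ) (C : ℝ) (ha : ∀ k, ‖a k‖ ≤ C)
    (ξ : lp (fun _ : ι => ℂ) 2) (k : ι) : weightedShift σ a C ha ξ k = a k * ξ (σ k) := rfl

variable {G : Type v} [AddCommGroup G] {X : Type u} [TopologicalSpace X] {β : PartialAction G X}

open scoped Classical in
/-- The values of a coefficient along the orbit of `x`: `k ↦ f (β_k⁻¹ x)` where `x ∈ D_k`, and `0`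
elsewhere. -/
def orbitFun (x : X) {n : G} (f : β.Coeff n) (k : G) : ℂ :=
  if x ∈ β.dom k then f.1 ((β.map k).symm x) else 0

theorem norm_orbitFun_le (x : X) {n : G} (f : β.Coeff n) (k : G) : ‖orbitFun x f k‖ ≤ ‖f.1‖ := by
  unfold orbitFun
  split_ifs
  · exact norm_apply_le_norm _ _
  · simp

/-- `orbitFun` turns the product of monomials into the composition of weighted shifts. -/
theorem orbitFun_mulCoeff (x : X) {n m : G} (f : β.Coeff n) (g : β.Coeff m) (k : G) :
    orbitFun x (mulCoeff n m f g) k = orbitFun x f k * orbitFun x g (k + n) := by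
  unfold orbitFun
  by_cases hk : x ∈ β.dom k
  · rw [if_pos hk, if_pos hk]
    by_cases hn : x ∈ β.dom (k + n)
    · rw [if_pos hn, mulCoeff_of_mem _ _ ((β.symm_mem_iff hk).2 hn), β.symm_symm hk hn]
    · rw [if_neg hn, mulCoeff_of_notMem _ _ fun h => hn ((β.symm_mem_iff hk).1 h), mul_zero]
  · rw [if_neg hk, if_neg hk, zero_mul]

/-- `orbitFun` turns the adjoint of a monomial into the adjoint of a weighted shift. -/
theorem orbitFun_starCoeff [T2Space X] (x : X) {n : G} (f : β.Coeff n) (k : G) :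
    orbitFun x (starCoeff n f) (k + n) = star (orbitFun x f k) := by
  unfold orbitFun
  have hkn : k + n + -n = k := add_neg_cancel_right k n
  by_cases hn : x ∈ β.dom (k + n)
  · have hiff := β.symm_mem_iff (m := -n) hn
    rw [hkn] at hiff
    rw [if_pos hn]
    by_cases hk : x ∈ β.dom k
    · have h1 := hiff.2 hk
      have h2 : β.map n ((β.map (k + n)).symm x) = (β.map k).symm x := by
        have := β.symm_symm (m := -n) hn (by rwa [hkn])
        rwa [β.symm_eq h1, neg_neg, hkn] at this
      rw [if_pos hk, starCoeff_of_mem _ h1, h2]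
    · rw [if_neg hk, starCoeff_of_notMem _ fun h => hk (hiff.1 h), star_zero]
  · rw [if_neg hn]
    by_cases hk : x ∈ β.dom k
    · rw [if_pos hk, ideal_apply f fun h => hn ((β.symm_mem_iff hk).1 h), star_zero]
    · rw [if_neg hk, star_zero]

variable [T2Space X]

/-- The shift by `n` on a copy of `G` in the universe of the representation spaces. -/
def shift (n : G) : ULift.{u} G ≃ ULift.{u} G :=
  Equiv.ulift.trans ((Equiv.addRight n).trans Equiv.ulift.symm)

open scoped InnerProductSpace in
/-- The regular representation along the orbit of `x`, on `ℓ²(G)`: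
`(f U^n ξ)(k) = f (β_k⁻¹ x) ξ (k + n)`. -/
def regularHom (β : PartialAction G X) (x : X) :
    Poly β →⋆ₙₐ[ℂ]
      (lp (fun _ : ULift.{u} G => ℂ) 2 →L[ℂ] lp (fun _ : ULift.{u} G => ℂ) 2) :=
  Poly.lift
    (fun n =>
      { toFun := fun f => weightedShift (shift n) (fun k => orbitFun x f k.down) ‖f.1‖
          fun k => norm_orbitFun_le x f k.down
        map_add' := fun f g => by
          ext ξ k
          change orbitFun x (f + g) _ * _ = orbitFun x f _ * _ + orbitFun x g _ * _
          unfold orbitFun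
          split_ifs <;> simp [add_mul]
        map_smul' := fun c f => by
          ext ξ k
          change orbitFun x (c • f) _ * _ = c * (orbitFun x f _ * _)
          unfold orbitFun
          split_ifs <;> simp [mul_assoc] })
    (fun n m f g => by
      ext ξ k
      change orbitFun x (mulCoeff n m f g) k.down * ξ ⟨k.down + (n + m)⟩ =
        orbitFun x f k.down * (orbitFun x g (k.down + n) * ξ ⟨k.down + n + m⟩)
      rw [orbitFun_mulCoeff, mul_assoc, add_assoc])
    (fun n f => by
      rw [ContinuousLinearMap.star_eq_adjoint, ContinuousLinearMap.eq_adjoint_iff]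
      intro ξ η
      rw [lp.inner_eq_tsum, lp.inner_eq_tsum, ← (shift n).tsum_eq]
      refine tsum_congr fun k => ?_
      have h1 : weightedShift (shift (-n)) (fun k => orbitFun x (starCoeff n f) k.down)
          ‖(starCoeff n f).1‖ (fun k => norm_orbitFun_le x _ k.down) ξ (shift n k) =
          star (orbitFun x f k.down) * ξ k := by
        rw [weightedShift_apply]
        have : shift (-n) (shift n k) = k := by
          change (⟨k.down + n + -n⟩ : ULift.{u} G) = k
          rw [add_neg_cancel_right]
        rw [this]
        congr 1
        exact orbitFun_starCoeff x f k.down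
      have h2 : weightedShift (shift n) (fun k => orbitFun x f k.down)
          ‖f.1‖ (fun k => norm_orbitFun_le x _ k.down) η k =
          orbitFun x f k.down * η (shift n k) := weightedShift_apply _ _ _ _ _ _
      refine (congrArg (fun z => ⟪z, η (shift n k)⟫_ℂ) h1).trans
        (Eq.trans ?_ (congrArg (fun z => ⟪ξ k, z⟫_ℂ) h2).symm)
      simp only [RCLike.inner_apply, map_mul, RCLike.star_def, RCLike.conj_conj]
      ring)

/-- `C₀(X)` embeds in the crossed product: the regular representation along the orbit of `x` maps
`f` to an operator whose matrix coefficient at `0` is `f x`. -/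
theorem apply_eq_zero_of_mono_eq_zero {f : C₀(X, ℂ)}
    (h : CrossedProduct.mono 0 (Poly.coeffZero (β := β) f) = 0) : f = 0 := by
  classical
  ext x
  have h1 : ‖Poly.mono 0 (Poly.coeffZero (β := β) f)‖ = 0 := by
    rw [← CrossedProduct.norm_ofPoly]
    exact norm_eq_zero.2 h
  have h2 := Poly.norm_apply_le_norm (regularHom β x) (Poly.mono 0 (Poly.coeffZero (β := β) f))
  rw [h1, norm_le_zero_iff, regularHom, Poly.lift_mono] at h2
  have h3 := congrArg (fun ξ : lp (fun _ : ULift.{u} G => ℂ) 2 => ξ ⟨0⟩)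
    (DFunLike.congr_fun h2 (lp.single 2 ⟨0⟩ 1))
  change orbitFun x (Poly.coeffZero (β := β) f) 0 *
    (lp.single 2 (⟨0⟩ : ULift.{u} G) (1 : ℂ) : lp (fun _ : ULift.{u} G => ℂ) 2) ⟨0 + 0⟩ = 0 at h3
  have h4 : (⟨0 + 0⟩ : ULift.{u} G) = ⟨0⟩ := by rw [add_zero]
  rw [h4, lp.single_apply_self, mul_one, orbitFun, if_pos (by simp [β.dom_zero]),
    β.symm_zero] at h3
  exact h3

end Regular

end PartialAction

/-! ### The conditional expectation and injectivity -/

namespace PartialAction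

namespace CrossedProduct

open MeasureTheory

variable {G : Type v} [AddCommGroup G] {X : Type u} [TopologicalSpace X] [T2Space X]
  {β : PartialAction G X}

/-- The dual action of the character group: `f U^n ↦ χ(n) f U^n`. -/
def gauge (χ : characters G) : CrossedProduct β →⋆ₙₐ[ℂ] CrossedProduct β :=
  twistedPullback (isProperIntertwiner_id β) χ

theorem gauge_mono (χ : characters G) (n : G) (f : β.Coeff n) :
    gauge χ (mono n f) = ((χ.1 n : Circle) : ℂ) • mono n f :=
  twistedPullback_mono _ χ n f

theorem gauge_one (a : CrossedProduct β) : gauge 1 a = a := by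
  have : gauge 1 = NonUnitalStarAlgHom.id ℂ (CrossedProduct β) :=
    hom_ext fun n f => by rw [gauge_mono]; simp
  rw [this]
  rfl

theorem gauge_twistedPullback_one {Y : Type u} [TopologicalSpace Y] [T2Space Y]
    {γ : PartialAction G Y} {φ : Y → X} (h : IsProperIntertwiner γ β φ) (χ : characters G)
    (a : CrossedProduct β) :
    twistedPullback h 1 (gauge χ a) = gauge χ (twistedPullback h 1 a) := by
  have : (twistedPullback h 1).comp (gauge χ) = (gauge χ).comp (twistedPullback h 1) :=
    hom_ext fun n f => by
      rw [NonUnitalStarAlgHom.comp_apply, NonUnitalStarAlgHom.comp_apply, gauge_mono, map_smul,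
        twistedPullback_one_mono, gauge_mono]
  exact DFunLike.congr_fun this a

theorem norm_gauge_le (χ : characters G) (a : CrossedProduct β) : ‖gauge χ a‖ ≤ ‖a‖ :=
  NonUnitalStarAlgHom.norm_apply_le _ _

/-- The dual action is pointwise norm-continuous: clear on polynomials, and preserved by uniform
limits as each `gauge χ` is contractive. -/
theorem continuous_gauge (a : CrossedProduct β) : Continuous fun χ : characters G => gauge χ a := by
  induction a using induction_on with
  | hp =>
    refine isClosed_of_closure_subset fun a ha => ?_
    refine continuous_of_uniform_approx_of_continuous fun s hs => ?_
    obtain ⟨ε, hε, hs⟩ := Metric.mem_uniformity_dist.1 hs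
    obtain ⟨b, hb, hab⟩ := Metric.mem_closure_iff.1 ha ε hε
    refine ⟨_, hb, fun χ => hs ?_⟩
    rw [dist_eq_norm, ← map_sub]
    exact (norm_gauge_le χ _).trans_lt (by rwa [← dist_eq_norm])
  | ih F =>
    induction F using Poly.induction with
    | h0 => simpa [ofPoly_zero] using continuous_const
    | hm n f =>
      change Continuous fun χ => gauge χ (mono n f)
      simp only [gauge_mono]
      exact (characters.continuous_eval n).smul continuous_const
    | ha F F' hF hF' =>
      simp only [ofPoly_add, _root_.map_add]
      exact hF.add hF'

instance : MeasurableSpace (characters G) := borel _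

instance : BorelSpace (characters G) := ⟨rfl⟩

/-- The normalized Haar measure of the character group. -/
def haar (G : Type v) [AddCommGroup G] : Measure (characters G) := Measure.haarMeasure ⊤

instance : (haar G).IsHaarMeasure := inferInstanceAs (Measure.haarMeasure ⊤).IsHaarMeasure

instance : IsProbabilityMeasure (haar G) := ⟨Measure.haarMeasure_self (K₀ := ⊤)⟩

/-- A nontrivial character of the compact group `characters G` has integral `0`. -/
theorem integral_eval {n : G} (hn : n ≠ 0) : ∫ χ, ((χ.1 n : Circle) : ℂ) ∂haar G = 0 := by
  obtain ⟨ψ, hψ⟩ := characters.exists_ne_one hn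
  have h1 : ∫ χ, (((ψ * χ).1 n : Circle) : ℂ) ∂haar G = ∫ χ, ((χ.1 n : Circle) : ℂ) ∂haar G :=
    integral_mul_left_eq_self (fun χ : characters G => ((χ.1 n : Circle) : ℂ)) ψ
  have h2 (χ : characters G) : (((ψ * χ).1 n : Circle) : ℂ) = (ψ.1 n : ℂ) * (χ.1 n : ℂ) := rfl
  simp only [h2] at h1
  rw [integral_const_mul] at h1
  by_contra h
  exact hψ (Circle.ext ((mul_eq_right₀ h).1 h1))

theorem integrable_gauge (a : CrossedProduct β) :
    Integrable (fun χ : characters G => gauge χ a) (haar G) :=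
  (continuous_gauge a).integrable_of_hasCompactSupport (HasCompactSupport.of_compactSpace _)

/-- The conditional expectation onto the coefficient algebra, as the average over the dual
action. -/
def expectation (a : CrossedProduct β) : CrossedProduct β := ∫ χ, gauge χ a ∂haar G

theorem expectation_add (a b : CrossedProduct β) :
    expectation (a + b) = expectation a + expectation b := by
  unfold expectation
  simp only [_root_.map_add]
  exact integral_add (integrable_gauge a) (integrable_gauge b)

theorem continuous_expectation : Continuous (expectation : CrossedProduct β → _) := by
  refine (LipschitzWith.of_dist_le_mul (K := 1) fun a b => ?_).continuous
  rw [NNReal.coe_one, one_mul, dist_eq_norm, dist_eq_norm]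
  unfold expectation
  rw [← integral_sub (integrable_gauge a) (integrable_gauge b)]
  refine (norm_integral_le_of_norm_le_const (C := ‖a - b‖) (Eventually.of_forall fun χ => ?_)).trans
    (by simp)
  rw [← map_sub]
  exact norm_gauge_le χ _

/-- The embedding of `C₀(X)` in degree `0`. -/
def ofCoeff (β : PartialAction G X) : C₀(X, ℂ) →⋆ₙₐ[ℂ] CrossedProduct β :=
  { (ofPolyHom β).comp (Poly.zeroHom β).toNonUnitalAlgHom with
    map_star' := fun f => by
      change ofPoly (Poly.zeroHom β (star f)) = star (ofPoly (Poly.zeroHom β f))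
      rw [map_star, ofPoly_star] }

theorem ofCoeff_apply (f : C₀(X, ℂ)) : ofCoeff β f = mono 0 (Poly.coeffZero f) := rfl

theorem injective_ofCoeff : Function.Injective (ofCoeff β) :=
  (injective_iff_map_eq_zero _).2 fun _ => apply_eq_zero_of_mono_eq_zero

theorem isClosed_range_ofCoeff : IsClosed (Set.range (ofCoeff β)) :=
  (NonUnitalStarAlgHom.isometry _ injective_ofCoeff).isClosedEmbedding.isClosed_range

/-- The average over the dual action kills all monomials of nonzero exponent, so it takes values in
the (closed) copy of `C₀(X)`. -/
theorem expectation_mem_range (a : CrossedProduct β) : expectation a ∈ Set.range (ofCoeff β) := by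
  induction a using induction_on with
  | hp => exact isClosed_range_ofCoeff.preimage continuous_expectation
  | ih F =>
    induction F using Poly.induction with
    | h0 =>
      refine ⟨0, ?_⟩
      simp [expectation, ofPoly_zero]
    | hm n f =>
      change expectation (mono n f) ∈ _
      unfold expectation
      simp only [gauge_mono]
      rw [integral_smul_const]
      by_cases hn : n = 0
      · subst hn
        refine ⟨f.1, ?_⟩
        simp only [characters.map_zero]
        simp
        rfl
      · rw [integral_eval hn, zero_smul]
        exact ⟨0, _root_.map_zero _⟩
    | ha F F' hF hF' =>
      obtain ⟨f, hf⟩ := hF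
      obtain ⟨f', hf'⟩ := hF'
      exact ⟨f + f', by rw [_root_.map_add, ofPoly_add, expectation_add, hf, hf']⟩

/-- The expectation is faithful: in every representation, `χ ↦ ‖π (τ_χ a) ξ‖²` is a continuous
nonnegative function, so it vanishes when its integral does. -/
theorem eq_zero_of_expectation {a : CrossedProduct β} (h : expectation (star a * a) = 0) :
    a = 0 := by
  refine eq_zero_of_ofRep fun π => ?_
  ext ξ
  let L : CrossedProduct β →L[ℂ] ℂ :=
    LinearMap.mkContinuous
      { toFun := fun b => inner ℂ ξ (ofRep π b ξ)
        map_add' := fun b c => by rw [_root_.map_add, add_apply, inner_add_right]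
        map_smul' := fun c b => by
          rw [_root_.map_smul, _root_.smul_apply, inner_smul_right]; rfl }
      (‖ξ‖ * ‖ξ‖) fun b => by
        refine (norm_inner_le_norm _ _).trans ?_
        rw [mul_assoc]
        gcongr
        refine (ContinuousLinearMap.le_opNorm _ _).trans ?_
        rw [mul_comm]
        gcongr
        exact NonUnitalStarAlgHom.norm_apply_le _ _
  -- `L` is the positive functional `b ↦ ⟪ξ, π b ξ⟫`.
  have hL (χ : characters G) :
      L (gauge χ (star a * a)) = ((‖ofRep π (gauge χ a) ξ‖ ^ 2 : ℝ) : ℂ) := by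
    change inner ℂ ξ (ofRep π (gauge χ (star a * a)) ξ) = _
    rw [map_mul, map_mul, map_star, map_star, ContinuousLinearMap.star_eq_adjoint,
      _root_.mul_apply_eq_comp, ContinuousLinearMap.adjoint_inner_right,
      inner_self_eq_norm_sq_to_K]
    norm_cast
  have hcont : Continuous fun χ : characters G => ‖ofRep π (gauge χ a) ξ‖ ^ 2 :=
    ((((continuous_hom (ofRep π)).comp (continuous_gauge a)).clm_apply
      continuous_const).norm).pow 2
  have h0 : ∫ χ : characters G, ‖ofRep π (gauge χ a) ξ‖ ^ 2 ∂haar G = 0 := by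
    have := L.integral_comp_comm (integrable_gauge (star a * a))
    simp only [hL] at this
    rw [integral_complex_ofReal] at this
    change _ = L (expectation (star a * a)) at this
    rw [h, _root_.map_zero] at this
    exact_mod_cast this
  have h1 := (integral_eq_zero_iff_of_nonneg (fun χ => by positivity)
    (hcont.integrable_of_hasCompactSupport (HasCompactSupport.of_compactSpace _))).1 h0
  have h2 := (hcont.ae_eq_iff_eq (haar G) continuous_const).1 h1
  have h3 : ‖ofRep π (gauge 1 a) ξ‖ ^ 2 = 0 := congrFun h2 1
  rw [gauge_one] at h3
  exact norm_eq_zero.1 (pow_eq_zero_iff two_ne_zero |>.1 h3)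

/-- The homomorphism induced by `φ` commutes with the expectations, is injective on `C₀(X)`, and the
expectation is faithful. -/
theorem injective_twistedPullback_one {Y : Type u} [TopologicalSpace Y] [T2Space Y]
    {γ : PartialAction G Y} {φ : Y → X} (h : IsProperIntertwiner γ β φ) :
    Function.Injective (twistedPullback h 1) := by
  refine (injective_iff_map_eq_zero _).2 fun a ha => eq_zero_of_expectation ?_
  obtain ⟨f, hf⟩ := expectation_mem_range (star a * a)
  let L : CrossedProduct β →L[ℂ] CrossedProduct γ :=
    LinearMap.mkContinuous
      ⟨⟨twistedPullback h 1, _root_.map_add _⟩, _root_.map_smul _⟩ 1 fun b => by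
        rw [one_mul]
        exact NonUnitalStarAlgHom.norm_apply_le (twistedPullback h 1) b
  have h1 : twistedPullback h 1 (expectation (star a * a)) = 0 := by
    refine (L.integral_comp_comm (integrable_gauge (star a * a))).symm.trans ?_
    refine integral_eq_zero_of_ae (Eventually.of_forall fun χ => ?_)
    change twistedPullback h 1 (gauge χ (star a * a)) = 0
    rw [gauge_twistedPullback_one, map_mul, ha, mul_zero, _root_.map_zero]
  rw [← hf, ofCoeff_apply, twistedPullback_one_mono] at h1
  have h2 := apply_eq_zero_of_mono_eq_zero (f := (pullback h 0 (Poly.coeffZero f)).1) h1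
  have h3 : f = 0 := by
    ext x
    obtain ⟨y, rfl⟩ := h.surjective x
    exact DFunLike.congr_fun h2 y
  rw [← hf, h3, _root_.map_zero]

end CrossedProduct

end PartialAction

/-! ### Direct limits of isometric sequences -/

section DirectLimit

variable {A : ℕ → Type*} [∀ i, NonUnitalNormedRing (A i)] [∀ i, NormedSpace ℂ (A i)]
  {Φ : ∀ i, A i →ₙₐ[ℂ] A (i + 1)} {B : Type*} [NonUnitalNormedRing B] [NormedSpace ℂ B]
  {Ψ : ∀ i, A i →ₙₐ[ℂ] B} {C : Type*} [NonUnitalNormedRing C] [NormedSpace ℂ C]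
  {ψ : ∀ i, A i →ₙₐ[ℂ] C}

/-- Elements can be moved along the sequence without changing their images in `B` and `C`. -/
theorem exists_lift_of_le (hΨ : ∀ i a, Ψ (i + 1) (Φ i a) = Ψ i a)
    (hψ : ∀ i a, ψ (i + 1) (Φ i a) = ψ i a) {i j : ℕ} (hij : i ≤ j) (a : A i) :
    ∃ a' : A j, Ψ j a' = Ψ i a ∧ ψ j a' = ψ i a := by
  induction j, hij using Nat.le_induction with
  | base => exact ⟨a, rfl, rfl⟩
  | succ j _ ih =>
    obtain ⟨a', h, h'⟩ := ih
    exact ⟨Φ j a', (hΨ j a').trans h, (hψ j a').trans h'⟩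

/-- The increasing union of the images of the algebras of a direct sequence. -/
def rangeUnion (hΨ : ∀ i a, Ψ (i + 1) (Φ i a) = Ψ i a) : Submodule ℂ B where
  carrier := ⋃ i, Set.range (Ψ i)
  zero_mem' := Set.mem_iUnion.2 ⟨0, 0, map_zero _⟩
  add_mem' {b b'} hb hb' := by
    obtain ⟨i, a, rfl⟩ := Set.mem_iUnion.1 hb
    obtain ⟨j, a', rfl⟩ := Set.mem_iUnion.1 hb'
    obtain ⟨c, hc, -⟩ := exists_lift_of_le hΨ hΨ (le_max_left i j) a
    obtain ⟨c', hc', -⟩ := exists_lift_of_le hΨ hΨ (le_max_right i j) a'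
    exact Set.mem_iUnion.2 ⟨max i j, c + c', by rw [map_add, hc, hc']⟩
  smul_mem' z b hb := by
    obtain ⟨i, a, rfl⟩ := Set.mem_iUnion.1 hb
    exact Set.mem_iUnion.2 ⟨i, z • a, map_smul _ _ _⟩

/-- If the maps `Ψ i : A i → B` of a direct sequence are isometric with dense union of ranges, then
compatible contractive homomorphisms on the `A i` extend to `B`. -/
theorem exists_contractive_hom [CompleteSpace C] (hnorm : ∀ i a, ‖Ψ i a‖ = ‖a‖)
    (hΨ : ∀ i a, Ψ (i + 1) (Φ i a) = Ψ i a) (hdense : Dense (⋃ i, Set.range (Ψ i)))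
    (hcontr : ∀ i a, ‖ψ i a‖ ≤ ‖a‖) (hψ : ∀ i a, ψ (i + 1) (Φ i a) = ψ i a) :
    ∃ χ : B →ₙₐ[ℂ] C, (∀ b, ‖χ b‖ ≤ ‖b‖) ∧ ∀ i a, χ (Ψ i a) = ψ i a := by
  have hinj (i : ℕ) (a a' : A i) (h : Ψ i a = Ψ i a') : a = a' := by
    rw [← sub_eq_zero, ← norm_eq_zero, ← hnorm, map_sub, h, sub_self, norm_zero]
  have hwd {i j : ℕ} (a : A i) (a' : A j) (h : Ψ i a = Ψ j a') : ψ i a = ψ j a' := by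
    obtain ⟨c, hc, hc1⟩ := exists_lift_of_le hΨ hψ (le_max_left i j) a
    obtain ⟨c', hc', hc1'⟩ := exists_lift_of_le hΨ hψ (le_max_right i j) a'
    rw [← hc1, ← hc1', hinj _ c c' (by rw [hc, hc', h])]
  choose k r hr using fun b : rangeUnion hΨ => Set.mem_iUnion.1 b.2
  have hval {i : ℕ} {a : A i} {b : rangeUnion hΨ} (h : Ψ i a = b) : ψ (k b) (r b) = ψ i a :=
    hwd _ _ ((hr b).trans h.symm)
  let f : rangeUnion hΨ →ₗ[ℂ] C :=
    { toFun := fun b => ψ (k b) (r b)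
      map_add' := fun b b' => by
        obtain ⟨c, hc, hc1⟩ := exists_lift_of_le hΨ hψ (le_max_left (k b) (k b')) (r b)
        obtain ⟨c', hc', hc1'⟩ := exists_lift_of_le hΨ hψ (le_max_right (k b) (k b')) (r b')
        rw [← hc1, ← hc1', ← map_add]
        exact hval (by rw [map_add, hc, hc', hr, hr]; rfl)
      map_smul' := fun z b => by
        rw [RingHom.id_apply, ← map_smul]
        exact hval (by rw [map_smul, hr]; rfl) }
  let E : B →L[ℂ] C := f.extendOfNorm (rangeUnion hΨ).subtype
  have hd : DenseRange (rangeUnion hΨ).subtype := by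
    rw [DenseRange]
    have : Set.range (rangeUnion hΨ).subtype = ⋃ i, Set.range (Ψ i) := Subtype.range_coe
    rwa [this]
  have hb : ∀ b : rangeUnion hΨ, ‖f b‖ ≤ 1 * ‖(rangeUnion hΨ).subtype b‖ := fun b => by
    rw [one_mul]
    refine (hcontr _ _).trans_eq ?_
    rw [← hnorm, hr]
    rfl
  have hE {i : ℕ} (a : A i) : E (Ψ i a) = ψ i a := by
    have := LinearMap.extendOfNorm_eq hd ⟨1, hb⟩ ⟨Ψ i a, Set.mem_iUnion.2 ⟨i, a, rfl⟩⟩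
    exact this.trans (hval rfl)
  have hind {p : B → Prop} (hp : IsClosed {b | p b}) (h : ∀ i a, p (Ψ i a)) (b : B) : p b := by
    refine hdense.induction (fun b hb => ?_) hp b
    obtain ⟨i, a, rfl⟩ := Set.mem_iUnion.1 hb
    exact h i a
  refine ⟨{ toFun := E, map_smul' := E.map_smul, map_zero' := E.map_zero, map_add' := E.map_add,
            map_mul' := fun b b' => ?_ }, fun b => ?_, fun i a => hE a⟩
  · induction b using hind with
    | hp =>
      exact isClosed_eq (E.continuous.comp (continuous_id.mul continuous_const))
        (E.continuous.mul continuous_const)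
    | h i a =>
      induction b' using hind with
      | hp =>
        exact isClosed_eq (E.continuous.comp (continuous_const.mul continuous_id))
          (continuous_const.mul E.continuous)
      | h j a' =>
        obtain ⟨c, hc, hc1⟩ := exists_lift_of_le hΨ hψ (le_max_left i j) a
        obtain ⟨c', hc', hc1'⟩ := exists_lift_of_le hΨ hψ (le_max_right i j) a'
        rw [← hc, ← hc', ← map_mul, hE, hE, hE, map_mul]
  · induction b using hind with
    | hp => exact isClosed_le E.continuous.norm continuous_norm
    | h i a =>
      change ‖E (Ψ i a)‖ ≤ _
      rw [hE, hnorm]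
      exact hcontr i a

end DirectLimit

/-! ### The inverse limit of a sequence of spaces -/

section InvLimit

variable {X : ℕ → Type u} {φ : ∀ i, X (i + 1) → X i}

namespace InvLimit

theorem map_proj (φ : ∀ i, X (i + 1) → X i) (x : InvLimit φ) (i : ℕ) :
    φ i (proj φ (i + 1) x) = proj φ i x := x.2 i

theorem ext {x y : InvLimit φ} (h : ∀ i, proj φ i x = proj φ i y) : x = y :=
  Subtype.ext (funext h)

theorem surjective_proj_zero (h : ∀ i, Function.Surjective (φ i)) :
    Function.Surjective (proj φ 0) := fun x =>
  ⟨⟨fun i => Nat.rec x (fun i y => Function.surjInv (h i) y) i,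
    fun i => Function.surjInv_eq (h i) _⟩, rfl⟩

theorem surjective_proj (h : ∀ i, Function.Surjective (φ i)) (i : ℕ) :
    Function.Surjective (proj φ i) := by
  induction i generalizing X with
  | zero => exact surjective_proj_zero h
  | succ i ih =>
    intro x
    obtain ⟨y, hy⟩ := ih (X := fun j => X (j + 1)) (φ := fun j => φ (j + 1)) (fun j => h (j + 1)) x
    refine ⟨⟨fun j => Nat.casesOn (motive := X) j (φ 0 (y.1 0)) y.1, fun j => ?_⟩, hy⟩
    cases j with
    | zero => rfl
    | succ j => exact y.2 j

variable [∀ i, TopologicalSpace (X i)]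

theorem continuous_proj (i : ℕ) : Continuous (proj φ i) :=
  (continuous_apply i).comp continuous_subtype_val

theorem isClosed [∀ i, T2Space (X i)] (hc : ∀ i, Continuous (φ i)) : IsClosed (InvLimit φ) := by
  have : InvLimit φ = ⋂ i, {x | φ i (x (i + 1)) = x i} := by
    ext x
    simp only [Set.mem_iInter]
    rfl
  rw [this]
  exact isClosed_iInter fun i =>
    isClosed_eq ((hc i).comp (continuous_apply _)) (continuous_apply _)

theorem isCompact_preimage_proj [∀ i, T2Space (X i)] (hc : ∀ i, Continuous (φ i))
    (hp : ∀ i K, IsCompact K → IsCompact (φ i ⁻¹' K)) (i : ℕ) {K : Set (X i)} (hK : IsCompact K) :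
    IsCompact (proj φ i ⁻¹' K) := by
  -- `P j`: the `j`-th coordinates of the points under consideration stay in a compact set.
  let P : ℕ → Prop := fun j => ∃ L : Set (X j), IsCompact L ∧ proj φ i ⁻¹' K ⊆ proj φ j ⁻¹' L
  have hdown (j : ℕ) : P (j + 1) → P j := fun ⟨L, hL, h⟩ =>
    ⟨φ j '' L, hL.image (hc j), fun x hx => ⟨_, h hx, map_proj φ x j⟩⟩
  have hup (j : ℕ) : P j → P (j + 1) := fun ⟨L, hL, h⟩ =>
    ⟨φ j ⁻¹' L, hp j L hL, fun x hx => by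
      rw [Set.mem_preimage, Set.mem_preimage, map_proj φ]
      exact h hx⟩
  have hzero (j : ℕ) : P j → P 0 := by
    induction j with
    | zero => exact id
    | succ j ih => exact fun h => ih (hdown j h)
  have hall (j : ℕ) : P j := by
    induction j with
    | zero => exact hzero i ⟨K, hK, subset_rfl⟩
    | succ j ih => exact hup j ih
  choose L hL hKL using hall
  have : proj φ i ⁻¹' K =
      Subtype.val ⁻¹' (Set.pi Set.univ L ∩ (fun x : ∀ j, X j => x i) ⁻¹' K) := by
    ext x
    exact ⟨fun hx => ⟨fun j _ => hKL j hx, hx⟩, fun hx => hx.2⟩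
  rw [this]
  exact (isClosed hc).isClosedEmbedding_subtypeVal.isCompact_preimage
    ((isCompact_univ_pi hL).inter_right (hK.isClosed.preimage (continuous_apply i)))

theorem locallyCompactSpace [∀ i, T2Space (X i)] [∀ i, LocallyCompactSpace (X i)]
    (hc : ∀ i, Continuous (φ i)) (hp : ∀ i K, IsCompact K → IsCompact (φ i ⁻¹' K)) :
    LocallyCompactSpace (InvLimit φ) := by
  have : WeaklyLocallyCompactSpace (InvLimit φ) := ⟨fun x => by
    obtain ⟨K, hK, hx⟩ := exists_compact_mem_nhds (proj φ 0 x)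
    exact ⟨_, isCompact_preimage_proj hc hp 0 hK, (continuous_proj 0).continuousAt hx⟩⟩
  infer_instance

end InvLimit

end InvLimit

namespace PartialAction

/-! ### The partial action on the inverse limit -/

section Limit

variable {G : Type v} [AddCommGroup G]

theorem map_mem_iff {X : Type u} [TopologicalSpace X] (β : PartialAction G X) {n m : G} {x : X}
    (hx : x ∈ β.dom (-n)) : β.map n x ∈ β.dom m ↔ x ∈ β.dom (-n + m) := by
  rw [← β.symm_mem_iff hx, β.symm_eq hx, neg_neg]

variable {X : ℕ → Type u} [∀ i, TopologicalSpace (X i)] {φ : ∀ i, X (i + 1) → X i}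
  {β : ∀ i, PartialAction G (X i)}

/-- The domains on the inverse limit can be read off at any level. -/
theorem limit_mem_dom_iff (h : ∀ i, IsProperIntertwiner (β (i + 1)) (β i) (φ i)) (g : G) (i : ℕ)
    (x : InvLimit φ) :
    InvLimit.proj φ i x ∈ (β i).dom g ↔ InvLimit.proj φ 0 x ∈ (β 0).dom g := by
  induction i with
  | zero => rfl
  | succ i ih => rw [← ih, ← InvLimit.map_proj φ x i, (h i).mem_dom_iff]

open scoped Classical in
/-- The coordinatewise partial map on the inverse limit, extended by the identity off its
domain. -/
def limitMap (h : ∀ i, IsProperIntertwiner (β (i + 1)) (β i) (φ i)) (g : G) (x : InvLimit φ) :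
    InvLimit φ :=
  if hx : InvLimit.proj φ 0 x ∈ (β 0).dom (-g) then
    ⟨fun i => (β i).map g (InvLimit.proj φ i x), fun i => by
      rw [← (h i).map_comm g _ ((limit_mem_dom_iff h _ (i + 1) x).2 hx), InvLimit.map_proj φ]⟩
  else x

theorem proj_limitMap (h : ∀ i, IsProperIntertwiner (β (i + 1)) (β i) (φ i)) {g : G}
    {x : InvLimit φ} (hx : InvLimit.proj φ 0 x ∈ (β 0).dom (-g)) (i : ℕ) :
    InvLimit.proj φ i (limitMap h g x) = (β i).map g (InvLimit.proj φ i x) := by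
  rw [limitMap, dif_pos hx]
  rfl

theorem limitMap_mem_iff (h : ∀ i, IsProperIntertwiner (β (i + 1)) (β i) (φ i)) {g k : G}
    {x : InvLimit φ} (hx : InvLimit.proj φ 0 x ∈ (β 0).dom (-g)) :
    InvLimit.proj φ 0 (limitMap h g x) ∈ (β 0).dom k ↔
      InvLimit.proj φ 0 x ∈ (β 0).dom (-g + k) := by
  rw [proj_limitMap h hx, (β 0).map_mem_iff hx]

theorem limitMap_mem (h : ∀ i, IsProperIntertwiner (β (i + 1)) (β i) (φ i)) {g : G}
    {x : InvLimit φ} (hx : InvLimit.proj φ 0 x ∈ (β 0).dom (-g)) :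
    InvLimit.proj φ 0 (limitMap h g x) ∈ (β 0).dom g := by
  rw [limitMap_mem_iff h hx, neg_add_cancel, (β 0).dom_zero]
  trivial

theorem limitMap_neg (h : ∀ i, IsProperIntertwiner (β (i + 1)) (β i) (φ i)) {g : G}
    {x : InvLimit φ} (hx : InvLimit.proj φ 0 x ∈ (β 0).dom (-g)) :
    limitMap h (-g) (limitMap h g x) = x := by
  refine InvLimit.ext fun i => ?_
  rw [proj_limitMap h (by rw [neg_neg]; exact limitMap_mem h hx), proj_limitMap h hx,
    (β i).neg_map ((limit_mem_dom_iff h _ i x).2 hx)]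

theorem continuousOn_limitMap (h : ∀ i, IsProperIntertwiner (β (i + 1)) (β i) (φ i)) (g : G) :
    ContinuousOn (limitMap h g) (InvLimit.proj φ 0 ⁻¹' (β 0).dom (-g)) := by
  rw [Topology.IsInducing.subtypeVal.continuousOn_iff, continuousOn_pi]
  intro i
  have h1 : ContinuousOn (fun x => (β i).map g (InvLimit.proj φ i x))
      (InvLimit.proj φ 0 ⁻¹' (β 0).dom (-g)) := by
    refine ((β i).map g).continuousOn.comp (InvLimit.continuous_proj i).continuousOn ?_
    intro x hx
    rw [(β i).map_source]
    exact (limit_mem_dom_iff h _ i x).2 hx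
  exact h1.congr fun x hx => proj_limitMap h hx i

theorem limitMap_image (h : ∀ i, IsProperIntertwiner (β (i + 1)) (β i) (φ i)) (s t : G) :
    limitMap h s '' (InvLimit.proj φ 0 ⁻¹' (β 0).dom (-s) ∩ InvLimit.proj φ 0 ⁻¹' (β 0).dom t) =
      InvLimit.proj φ 0 ⁻¹' (β 0).dom s ∩ InvLimit.proj φ 0 ⁻¹' (β 0).dom (s + t) := by
  ext y
  constructor
  · rintro ⟨x, ⟨hx, hx'⟩, rfl⟩
    refine ⟨limitMap_mem h hx, (limitMap_mem_iff h hx).2 ?_⟩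
    rwa [neg_add_cancel_left]
  · rintro ⟨hy, hy'⟩
    have hy1 : InvLimit.proj φ 0 y ∈ (β 0).dom (- -s) := by rwa [neg_neg]
    refine ⟨limitMap h (-s) y, ⟨limitMap_mem h hy1, (limitMap_mem_iff h hy1).2 ?_⟩, ?_⟩
    · rwa [neg_neg]
    · simpa only [neg_neg] using limitMap_neg h hy1

/-- The coordinatewise partial action on the inverse limit. -/
def limit (h : ∀ i, IsProperIntertwiner (β (i + 1)) (β i) (φ i)) :
    PartialAction G (InvLimit φ) where
  dom g := InvLimit.proj φ 0 ⁻¹' (β 0).dom g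
  map g :=
    { toFun := limitMap h g
      invFun := limitMap h (-g)
      source := InvLimit.proj φ 0 ⁻¹' (β 0).dom (-g)
      target := InvLimit.proj φ 0 ⁻¹' (β 0).dom g
      map_source' := fun x hx => limitMap_mem h hx
      map_target' := fun x hx => limitMap_mem h (by rwa [neg_neg])
      left_inv' := fun x hx => limitMap_neg h hx
      right_inv' := fun x hx => by
        simpa only [neg_neg] using limitMap_neg h (g := -g) (x := x) (by rwa [neg_neg])
      open_source := ((β 0).isOpen_dom _).preimage (InvLimit.continuous_proj 0)
      open_target := ((β 0).isOpen_dom _).preimage (InvLimit.continuous_proj 0)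
      continuousOn_toFun := continuousOn_limitMap h g
      continuousOn_invFun := by simpa only [neg_neg] using continuousOn_limitMap h (-g) }
  map_source _ := rfl
  map_target _ := rfl
  image_inter_left := limitMap_image h
  image_inter_right s t := by
    -- This is the other axiom for the pair `t`, `-s - t`.
    have := limitMap_image h t (-s - t)
    rwa [add_sub_cancel] at this
  map_add s t x hx := by
    have hx1 : InvLimit.proj φ 0 x ∈ (β 0).dom (-t) := hx.1
    have hx2 : InvLimit.proj φ 0 x ∈ (β 0).dom (-s - t) := hx.2
    have hx3 : InvLimit.proj φ 0 x ∈ (β 0).dom (-(s + t)) := by rwa [neg_add']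
    have hx4 : InvLimit.proj φ 0 (limitMap h t x) ∈ (β 0).dom (-s) := by
      rwa [limitMap_mem_iff h hx1, neg_add_eq_sub, ← neg_add', add_comm, neg_add_rev,
        ← sub_eq_add_neg]
    refine InvLimit.ext fun i => ?_
    change InvLimit.proj φ i (limitMap h (s + t) x) =
      InvLimit.proj φ i (limitMap h s (limitMap h t x))
    rw [proj_limitMap h hx3, proj_limitMap h hx4, proj_limitMap h hx1]
    exact (β i).map_add s t _
      ⟨(limit_mem_dom_iff h _ i x).2 hx1, (limit_mem_dom_iff h _ i x).2 hx2⟩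
  dom_zero := by rw [(β 0).dom_zero, Set.preimage_univ]
  map_zero x := InvLimit.ext fun i => by
    change InvLimit.proj φ i (limitMap h 0 x) = _
    rw [proj_limitMap h (by rw [neg_zero, (β 0).dom_zero]; trivial), (β i).map_zero]

theorem isProperIntertwiner_proj [∀ i, T2Space (X i)]
    (h : ∀ i, IsProperIntertwiner (β (i + 1)) (β i) (φ i)) (i : ℕ) :
    IsProperIntertwiner (limit h) (β i) (InvLimit.proj φ i) where
  continuous := InvLimit.continuous_proj i
  surjective := InvLimit.surjective_proj (fun i => (h i).surjective) i
  isCompact_preimage _ hK := InvLimit.isCompact_preimage_proj (fun i => (h i).continuous)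
    (fun i => (h i).isCompact_preimage) i hK
  mem_dom_iff g x := limit_mem_dom_iff h g i x
  map_comm _ _ hx := (proj_limitMap h hx i).symm

end Limit

end PartialAction

/-! ### Approximation of coefficients on the inverse limit -/

section Approximation

variable {X : ℕ → Type u} [∀ i, TopologicalSpace (X i)] {φ : ∀ i, X (i + 1) → X i}

namespace InvLimit

/-- The composite connecting map `X i → X 0`. -/
def toZero (φ : ∀ i, X (i + 1) → X i) : ∀ i, X i → X 0
  | 0 => id
  | i + 1 => toZero φ i ∘ φ i

omit [∀ i, TopologicalSpace (X i)] in
theorem toZero_proj (i : ℕ) (x : InvLimit φ) : toZero φ i (proj φ i x) = proj φ 0 x := by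
  induction i with
  | zero => rfl
  | succ i ih =>
    change toZero φ i (φ i (proj φ (i + 1) x)) = _
    rw [map_proj φ, ih]

theorem continuous_toZero (hc : ∀ i, Continuous (φ i)) (i : ℕ) : Continuous (toZero φ i) := by
  induction i with
  | zero => exact continuous_id
  | succ i ih => exact ih.comp (hc i)

theorem isCompact_preimage_toZero (hp : ∀ i K, IsCompact K → IsCompact (φ i ⁻¹' K)) (i : ℕ)
    {K : Set (X 0)} (hK : IsCompact K) : IsCompact (toZero φ i ⁻¹' K) := by
  induction i with
  | zero => exact hK
  | succ i ih => exact hp i _ ih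

theorem exists_comp_proj_of_le (hc : ∀ i, Continuous (φ i)) {i j : ℕ} (hij : i ≤ j)
    (g : C(X i, ℂ)) : ∃ g' : C(X j, ℂ), ∀ x, g' (proj φ j x) = g (proj φ i x) := by
  induction j, hij using Nat.le_induction with
  | base => exact ⟨g, fun _ => rfl⟩
  | succ j _ ih =>
    obtain ⟨g', hg⟩ := ih
    refine ⟨g'.comp ⟨φ j, hc j⟩, fun x => ?_⟩
    rw [← hg, ← map_proj φ x j]
    rfl

/-- The functions on a subset of the inverse limit which factor through some `X i`. -/
def cylinderAlgebra (hc : ∀ i, Continuous (φ i)) (L : Set (InvLimit φ)) :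
    StarSubalgebra ℂ C(L, ℂ) where
  carrier := {f | ∃ i, ∃ g : C(X i, ℂ), ∀ x : L, f x = g (proj φ i x)}
  mul_mem' {f f'} := by
    rintro ⟨i, g, hg⟩ ⟨j, g', hg'⟩
    obtain ⟨k, hk⟩ := exists_comp_proj_of_le hc (le_max_left i j) g
    obtain ⟨k', hk'⟩ := exists_comp_proj_of_le hc (le_max_right i j) g'
    exact ⟨max i j, k * k', fun x => by
      rw [ContinuousMap.mul_apply, ContinuousMap.mul_apply, hg, hg', hk, hk']⟩
  add_mem' {f f'} := by
    rintro ⟨i, g, hg⟩ ⟨j, g', hg'⟩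
    obtain ⟨k, hk⟩ := exists_comp_proj_of_le hc (le_max_left i j) g
    obtain ⟨k', hk'⟩ := exists_comp_proj_of_le hc (le_max_right i j) g'
    exact ⟨max i j, k + k', fun x => by
      rw [ContinuousMap.add_apply, ContinuousMap.add_apply, hg, hg', hk, hk']⟩
  algebraMap_mem' c := ⟨0, algebraMap ℂ _ c, fun _ => rfl⟩
  star_mem' {f} := by
    rintro ⟨i, g, hg⟩
    exact ⟨i, star g, fun x => congrArg star (hg x)⟩

theorem separatesPoints_cylinderAlgebra [∀ i, T2Space (X i)] [∀ i, LocallyCompactSpace (X i)]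
    (hc : ∀ i, Continuous (φ i)) (L : Set (InvLimit φ)) :
    (cylinderAlgebra hc L).SeparatesPoints := by
  intro x y hxy
  obtain ⟨i, hi⟩ : ∃ i, proj φ i x.1 ≠ proj φ i y.1 := by
    by_contra! h
    exact hxy (Subtype.ext (InvLimit.ext h))
  obtain ⟨u, h1, h0, -, -⟩ := exists_continuous_one_zero_of_isCompact
    (isCompact_singleton (x := proj φ i x.1)) (isClosed_singleton (x := proj φ i y.1))
    (Set.disjoint_singleton.2 hi)
  let g : C(X i, ℂ) := ⟨fun z => (u z : ℂ), Complex.continuous_ofReal.comp u.continuous⟩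
  refine ⟨_, ⟨g.comp ⟨fun z : L => proj φ i z.1, (continuous_proj i).comp continuous_subtype_val⟩,
    ⟨i, g, fun _ => rfl⟩, rfl⟩, ?_⟩
  change (u (proj φ i x.1) : ℂ) ≠ (u (proj φ i y.1) : ℂ)
  rw [h1 rfl, h0 rfl]
  simp

end InvLimit

namespace PartialAction

variable [∀ i, T2Space (X i)] [∀ i, LocallyCompactSpace (X i)] {G : Type v} [AddCommGroup G]
  {β : ∀ i, PartialAction G (X i)}

/-- Coefficients on the inverse limit are approximated by coefficients pulled back from the
`X i`: cut off by a compactly supported function on `D_n ⊆ X 0`, then apply the Stone-Weierstrass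
theorem on the compact preimage of its support. -/
theorem exists_pullback_near (h : ∀ i, IsProperIntertwiner (β (i + 1)) (β i) (φ i)) {n : G}
    (f : (limit h).Coeff n) {ε : ℝ} (hε : 0 < ε) :
    ∃ i, ∃ g : (β i).Coeff n,
      ‖f.1 - (pullback (isProperIntertwiner_proj h i) n g).1‖ ≤ ε + ε := by
  have hc i := (h i).continuous
  have hp i := (h i).isCompact_preimage
  have hdisj : Disjoint (InvLimit.proj φ 0 '' {x | ε ≤ ‖f.1 x‖}) ((β 0).dom n)ᶜ := by
    rw [Set.disjoint_compl_right_iff_subset]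
    rintro _ ⟨x, hx, rfl⟩
    by_contra hx'
    have hx2 : ε ≤ ‖f.1 x‖ := hx
    rw [ideal_apply f hx', norm_zero] at hx2
    exact hx2.not_gt hε
  obtain ⟨u, h1, h0, hu, hu01⟩ := exists_continuous_one_zero_of_isCompact
    ((isCompact_le_norm f.1 hε).image (InvLimit.continuous_proj 0))
    ((β 0).isOpen_dom n).isClosed_compl hdisj
  let L : Set (InvLimit φ) := InvLimit.proj φ 0 ⁻¹' tsupport u
  have hL : IsCompact L := InvLimit.isCompact_preimage_proj hc hp 0 hu
  have : CompactSpace L := isCompact_iff_compactSpace.1 hL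
  let fL : C(L, ℂ) := ⟨fun x => f.1 x.1, (map_continuous f.1).comp continuous_subtype_val⟩
  have hfL : fL ∈ closure (InvLimit.cylinderAlgebra hc L : Set C(L, ℂ)) := by
    have := ContinuousMap.starSubalgebra_topologicalClosure_eq_top_of_separatesPoints _
      (InvLimit.separatesPoints_cylinderAlgebra hc L)
    rw [← StarSubalgebra.topologicalClosure_coe, this]
    trivial
  obtain ⟨k, ⟨i, g, hg⟩, hk⟩ := Metric.mem_closure_iff.1 hfL ε hε
  let g' : X i → ℂ := fun z => g z * (u (InvLimit.toZero φ i z) : ℂ)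
  have hg'c : Continuous g' := g.continuous.mul
    (Complex.continuous_ofReal.comp (u.continuous.comp (InvLimit.continuous_toZero hc i)))
  have hg's : HasCompactSupport g' :=
    HasCompactSupport.intro (InvLimit.isCompact_preimage_toZero hp i hu) fun z hz => by
      have : u (InvLimit.toZero φ i z) = 0 := image_eq_zero_of_notMem_tsupport hz
      simp [g', this]
  have hq (x : InvLimit φ) : g' (InvLimit.proj φ i x) =
      g (InvLimit.proj φ i x) * (u (InvLimit.proj φ 0 x) : ℂ) := by
    change _ * (u (InvLimit.toZero φ i (InvLimit.proj φ i x)) : ℂ) = _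
    rw [InvLimit.toZero_proj]
  refine ⟨i, ⟨⟨⟨g', hg'c⟩, hg's.is_zero_at_infty⟩, fun z hz => ?_⟩, ?_⟩
  · obtain ⟨x, rfl⟩ := InvLimit.surjective_proj (fun i => (h i).surjective) i z
    change g' _ = 0
    have hx : InvLimit.proj φ 0 x ∈ ((β 0).dom n)ᶜ :=
      fun hx => hz ((limit_mem_dom_iff h n i x).2 hx)
    rw [hq, h0 hx]
    simp
  · refine norm_le_of_forall (by positivity) fun x => ?_
    change ‖f.1 x - g' (InvLimit.proj φ i x)‖ ≤ _
    rw [hq]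
    have hu0 := (hu01 (InvLimit.proj φ 0 x)).1
    have hu1 := (hu01 (InvLimit.proj φ 0 x)).2
    -- The first term is small where `f` is, and `u = 1` elsewhere; the second is small on `L`, and
    -- `u = 0` off `L`.
    have e : f.1 x - g (InvLimit.proj φ i x) * (u (InvLimit.proj φ 0 x) : ℂ) =
        f.1 x * ((1 - u (InvLimit.proj φ 0 x) : ℝ) : ℂ) +
          (f.1 x - g (InvLimit.proj φ i x)) * (u (InvLimit.proj φ 0 x) : ℂ) := by
      push_cast
      ring
    rw [e]
    refine (norm_add_le _ _).trans (add_le_add ?_ ?_)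
    · by_cases hx : ε ≤ ‖f.1 x‖
      · rw [h1 (Set.mem_image_of_mem _ hx)]
        simp [hε.le]
      · rw [norm_mul, Complex.norm_real, Real.norm_of_nonneg (by linarith)]
        nlinarith [norm_nonneg (f.1 x)]
    · by_cases hx : x ∈ L
      · have hd : ‖f.1 x - g (InvLimit.proj φ i x)‖ ≤ ε := by
          have := (ContinuousMap.dist_apply_le_dist (f := fL) (g := k) ⟨x, hx⟩).trans hk.le
          rw [hg, dist_eq_norm] at this
          exact this
        rw [norm_mul, Complex.norm_real, Real.norm_of_nonneg hu0]
        nlinarith [norm_nonneg (f.1 x - g (InvLimit.proj φ i x))]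
      · have : u (InvLimit.proj φ 0 x) = 0 := image_eq_zero_of_notMem_tsupport hx
        simp [this, hε.le]

end PartialAction

end Approximation

/-! ### Analytic crossed products -/

namespace PartialAction

section Analytic

variable {G : Type v} [AddCommGroup G] {X : Type u} [TopologicalSpace X] [T2Space X]
  {β : PartialAction G X}

theorem CrossedProduct.norm_mono_le {n : G} (f : β.Coeff n) :
    ‖CrossedProduct.mono n f‖ ≤ ‖f.1‖ := by
  rw [CrossedProduct.mono, CrossedProduct.norm_ofPoly]
  exact Poly.cnorm_le fun π => Poly.norm_hom_mono_le π f

theorem CrossedProduct.mono_sub {n : G} (f g : β.Coeff n) :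
    CrossedProduct.mono n (f - g) = CrossedProduct.mono n f - CrossedProduct.mono n g := by
  have : Poly.mono n (f - g) = Poly.mono n f - Poly.mono n g := (Poly.monoHom n).map_sub f g
  exact (congrArg _ this).trans (_root_.map_sub (CrossedProduct.ofPolyHom β) _ _)

theorem CrossedProduct.ofPoly_mem {U : Submodule ℂ (CrossedProduct β)} {S : Set G}
    (hU : ∀ n ∈ S, ∀ f, CrossedProduct.mono n f ∈ U) {F : Poly β} (hF : ∀ n ∉ S, F.coeff n = 0) :
    CrossedProduct.ofPoly F ∈ U := by
  obtain ⟨s, hs⟩ := Poly.sum_coeff F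
  rw [← hs]
  change CrossedProduct.ofPolyHom β _ ∈ U
  rw [map_sum]
  refine U.sum_mem fun n _ => ?_
  by_cases hn : n ∈ S
  · exact hU n hn _
  · have : Poly.mono n (F.coeff n) = 0 := by
      rw [hF n hn]
      exact (Poly.monoHom n).map_zero
    rw [this, _root_.map_zero]
    exact U.zero_mem

/-- Monomials span a dense subspace of the crossed product. -/
theorem CrossedProduct.mem_of_mono_mem {U : Submodule ℂ (CrossedProduct β)}
    (hc : IsClosed (U : Set (CrossedProduct β))) (hU : ∀ n f, CrossedProduct.mono n f ∈ U)
    (a : CrossedProduct β) : a ∈ U := by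
  induction a using CrossedProduct.induction_on with
  | hp => exact hc
  | ih F =>
    exact CrossedProduct.ofPoly_mem (S := Set.univ) (fun n _ => hU n)
      fun n hn => absurd (Set.mem_univ n) hn

theorem isClosed_analytic (S : PositiveCone G) :
    IsClosed (β.analytic S : Set (CrossedProduct β)) :=
  NonUnitalSubalgebra.isClosed_topologicalClosure _

/-- Monomials with exponents in the cone span a dense subspace of the analytic crossed product. -/
theorem mem_of_mem_analytic {S : PositiveCone G} {U : Submodule ℂ (CrossedProduct β)}
    (hc : IsClosed (U : Set (CrossedProduct β)))
    (hU : ∀ n ∈ S.carrier, ∀ f, CrossedProduct.mono n f ∈ U)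
    {a : CrossedProduct β} (ha : a ∈ β.analytic S) : a ∈ U := by
  have ha' : a ∈ closure
      ((Poly.analytic β S).map (CrossedProduct.ofPolyHom β) : Set (CrossedProduct β)) := ha
  refine closure_minimal ?_ hc ha'
  rintro _ ⟨F, hF, rfl⟩
  exact CrossedProduct.ofPoly_mem hU hF

theorem mono_mem_analytic {S : PositiveCone G} {n : G} (hn : n ∈ S.carrier) (f : β.Coeff n) :
    CrossedProduct.mono n f ∈ β.analytic S := by
  refine NonUnitalSubalgebra.le_topologicalClosure _ ⟨Poly.mono n f, fun m hm => ?_, rfl⟩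
  exact Poly.coeff_mono_of_ne f fun h => hm (h ▸ hn)

variable {Y : Type u} [TopologicalSpace Y] [T2Space Y] {γ : PartialAction G Y} {φ : Y → X}

theorem twistedPullback_one_mem_analytic (h : IsProperIntertwiner γ β φ) (S : PositiveCone G)
    {a : CrossedProduct β} (ha : a ∈ β.analytic S) :
    CrossedProduct.twistedPullback h 1 a ∈ γ.analytic S := by
  let T : CrossedProduct β →ₗ[ℂ] CrossedProduct γ :=
    ⟨⟨CrossedProduct.twistedPullback h 1, _root_.map_add _⟩, _root_.map_smul _⟩
  refine mem_of_mem_analytic (U := (γ.analytic S).toSubmodule.comap T)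
    ((isClosed_analytic S).preimage
      (CrossedProduct.continuous_hom (CrossedProduct.twistedPullback h 1))) (fun n hn f => ?_) ha
  change CrossedProduct.twistedPullback h 1 (CrossedProduct.mono n f) ∈ γ.analytic S
  rw [CrossedProduct.twistedPullback_one_mono]
  exact mono_mem_analytic hn _

/-- The homomorphism of analytic crossed products induced by a proper intertwiner. -/
def analyticMap (h : IsProperIntertwiner γ β φ) (S : PositiveCone G) :
    β.analytic S →ₙₐ[ℂ] γ.analytic S where
  toFun a := ⟨CrossedProduct.twistedPullback h 1 a, twistedPullback_one_mem_analytic h S a.2⟩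
  map_smul' c a := Subtype.ext (_root_.map_smul (CrossedProduct.twistedPullback h 1) c a.1)
  map_zero' := Subtype.ext (_root_.map_zero (CrossedProduct.twistedPullback h 1))
  map_add' a b := Subtype.ext (_root_.map_add (CrossedProduct.twistedPullback h 1) a.1 b.1)
  map_mul' a b := Subtype.ext (map_mul (CrossedProduct.twistedPullback h 1) a.1 b.1)

theorem norm_twistedPullback_one (h : IsProperIntertwiner γ β φ) (a : CrossedProduct β) :
    ‖CrossedProduct.twistedPullback h 1 a‖ = ‖a‖ :=
  NonUnitalStarAlgHom.norm_map _ (CrossedProduct.injective_twistedPullback_one h) a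

end Analytic

/-! ### The direct limit of the crossed products -/

section Sequence

variable {G : Type v} [AddCommGroup G] {X : ℕ → Type u} [∀ i, TopologicalSpace (X i)]
  [∀ i, T2Space (X i)] {φ : ∀ i, X (i + 1) → X i} {β : ∀ i, PartialAction G (X i)}

theorem twistedPullback_proj_succ (h : ∀ i, IsProperIntertwiner (β (i + 1)) (β i) (φ i)) (i : ℕ)
    (a : (β i).CrossedProduct) :
    CrossedProduct.twistedPullback (isProperIntertwiner_proj h (i + 1)) 1
      (CrossedProduct.twistedPullback (h i) 1 a) =
      CrossedProduct.twistedPullback (isProperIntertwiner_proj h i) 1 a := by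
  have : (CrossedProduct.twistedPullback (isProperIntertwiner_proj h (i + 1)) 1).comp
      (CrossedProduct.twistedPullback (h i) 1) =
      CrossedProduct.twistedPullback (isProperIntertwiner_proj h i) 1 :=
    CrossedProduct.hom_ext fun n f => by
      rw [NonUnitalStarAlgHom.comp_apply, CrossedProduct.twistedPullback_one_mono,
        CrossedProduct.twistedPullback_one_mono, CrossedProduct.twistedPullback_one_mono]
      congr 1
      refine ideal_ext fun x => ?_
      rw [pullback_apply, pullback_apply, pullback_apply, InvLimit.map_proj φ]
  exact DFunLike.congr_fun this a

variable [∀ i, LocallyCompactSpace (X i)]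

/-- A closed subspace containing the monomials `(g ∘ p_i) U^n` contains all `f U^n`. -/
theorem mono_mem_of_pullback_mem (h : ∀ i, IsProperIntertwiner (β (i + 1)) (β i) (φ i))
    {U : Submodule ℂ (limit h).CrossedProduct} (hc : IsClosed (U : Set (limit h).CrossedProduct))
    {n : G}
    (hU : ∀ i (g : (β i).Coeff n),
      CrossedProduct.twistedPullback (isProperIntertwiner_proj h i) 1 (CrossedProduct.mono n g) ∈ U)
    (f : (limit h).Coeff n) : CrossedProduct.mono n f ∈ U := by
  rw [← SetLike.mem_coe, ← hc.closure_eq, Metric.mem_closure_iff]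
  intro ε hε
  obtain ⟨i, g, hg⟩ := exists_pullback_near h f (ε := ε / 4) (by positivity)
  refine ⟨_, hU i g, ?_⟩
  rw [CrossedProduct.twistedPullback_one_mono, dist_eq_norm, ← CrossedProduct.mono_sub]
  refine (CrossedProduct.norm_mono_le _).trans_lt (lt_of_le_of_lt hg ?_)
  linarith

theorem dense_iUnion_range (h : ∀ i, IsProperIntertwiner (β (i + 1)) (β i) (φ i)) :
    Dense (⋃ i, Set.range
      (CrossedProduct.twistedPullback (isProperIntertwiner_proj h i) (1 : characters G))) := by
  let U : Submodule ℂ (limit h).CrossedProduct := rangeUnion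
    (Φ := fun i => (CrossedProduct.twistedPullback (h i) 1).toNonUnitalAlgHom)
    (Ψ := fun i =>
      (CrossedProduct.twistedPullback (isProperIntertwiner_proj h i) 1).toNonUnitalAlgHom)
    (twistedPullback_proj_succ h)
  intro a
  refine CrossedProduct.mem_of_mono_mem (U := U.topologicalClosure) U.isClosed_topologicalClosure
    (fun n f => ?_) a
  exact mono_mem_of_pullback_mem h U.isClosed_topologicalClosure
    (fun i g => U.le_topologicalClosure (Set.mem_iUnion.2 ⟨i, _, rfl⟩)) f

theorem analytic_limit_eq_closure (h : ∀ i, IsProperIntertwiner (β (i + 1)) (β i) (φ i))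
    (S : PositiveCone G) :
    ((limit h).analytic S : Set (limit h).CrossedProduct) =
      closure (⋃ i, CrossedProduct.twistedPullback (isProperIntertwiner_proj h i) 1 ''
        ((β i).analytic S : Set (β i).CrossedProduct)) := by
  have hsub : (⋃ i, CrossedProduct.twistedPullback (isProperIntertwiner_proj h i) 1 ''
      ((β i).analytic S : Set (β i).CrossedProduct)) ⊆ (limit h).analytic S := by
    refine Set.iUnion_subset fun i => ?_
    rintro _ ⟨a, ha, rfl⟩
    exact twistedPullback_one_mem_analytic _ S ha
  refine subset_antisymm (fun a ha => ?_) (closure_minimal hsub (isClosed_analytic S))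
  let U : Submodule ℂ (limit h).CrossedProduct := rangeUnion
    (A := fun i => (β i).analytic S)
    (Φ := fun i => analyticMap (h i) S)
    (Ψ := fun i =>
      (CrossedProduct.twistedPullback (isProperIntertwiner_proj h i) 1).toNonUnitalAlgHom.comp
        (NonUnitalSubalgebraClass.subtype ((β i).analytic S)))
    (fun i a => twistedPullback_proj_succ h i a.1)
  have hU : (U : Set (limit h).CrossedProduct) ⊆
      ⋃ i, CrossedProduct.twistedPullback (isProperIntertwiner_proj h i) 1 ''
        ((β i).analytic S : Set (β i).CrossedProduct) := by
    intro b hb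
    obtain ⟨i, c, rfl⟩ := Set.mem_iUnion.1 hb
    exact Set.mem_iUnion.2 ⟨i, c.1, c.2, rfl⟩
  refine closure_mono hU (mem_of_mem_analytic (U := U.topologicalClosure)
    U.isClosed_topologicalClosure (fun n hn f => ?_) ha)
  exact mono_mem_of_pullback_mem h U.isClosed_topologicalClosure
    (fun i g => U.le_topologicalClosure
      (Set.mem_iUnion.2 ⟨i, ⟨_, mono_mem_analytic hn g⟩, rfl⟩)) f

theorem isCStarDirectLimit (h : ∀ i, IsProperIntertwiner (β (i + 1)) (β i) (φ i)) :
    IsCStarDirectLimit.{max u v, max u v, w}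
      (fun i => CrossedProduct.twistedPullback (h i) (1 : characters G))
      (fun i => CrossedProduct.twistedPullback (isProperIntertwiner_proj h i) 1) := by
  refine ⟨twistedPullback_proj_succ h, fun C _ ψ hψ => ?_⟩
  have hind {p : (limit h).CrossedProduct → Prop} (hp : IsClosed {b | p b})
      (H : ∀ i a, p (CrossedProduct.twistedPullback (isProperIntertwiner_proj h i) 1 a))
      (b : (limit h).CrossedProduct) : p b := by
    refine (dense_iUnion_range h).induction (fun b hb => ?_) hp b
    obtain ⟨i, a, rfl⟩ := Set.mem_iUnion.1 hb
    exact H i a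
  obtain ⟨χ, hχ, hχψ⟩ := exists_contractive_hom
    (Φ := fun i => (CrossedProduct.twistedPullback (h i) 1).toNonUnitalAlgHom)
    (Ψ := fun i =>
      (CrossedProduct.twistedPullback (isProperIntertwiner_proj h i) 1).toNonUnitalAlgHom)
    (ψ := fun i => (ψ i).toNonUnitalAlgHom)
    (fun i a => norm_twistedPullback_one _ a) (twistedPullback_proj_succ h)
    (dense_iUnion_range h) (fun i a => NonUnitalStarAlgHom.norm_apply_le (ψ i) a) hψ
  have hcont : Continuous χ :=
    (AddMonoidHomClass.lipschitz_of_bound χ 1 fun b => by rw [one_mul]; exact hχ b).continuous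
  have hχψ' (i : ℕ) (a : (β i).CrossedProduct) :
      χ (CrossedProduct.twistedPullback (isProperIntertwiner_proj h i) 1 a) = ψ i a := hχψ i a
  refine ⟨{ χ with map_star' := fun b => ?_ }, hχψ, fun χ' hχ' => ?_⟩
  · change χ (star b) = star (χ b)
    induction b using hind with
    | hp => exact isClosed_eq (hcont.comp continuous_star) (continuous_star.comp hcont)
    | H i a => rw [← map_star, hχψ', hχψ', map_star]
  · ext b
    change χ' b = χ b
    induction b using hind with
    | hp => exact isClosed_eq (CrossedProduct.continuous_hom χ') hcont
    | H i a => exact (hχ' i a).trans (hχψ' i a).symm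

theorem isBanachDirectLimit_analytic (h : ∀ i, IsProperIntertwiner (β (i + 1)) (β i) (φ i))
    (S : PositiveCone G) :
    IsBanachDirectLimit.{max u v, max u v, w} (A := fun i => (β i).analytic S)
      (B := (limit h).analytic S) (fun i => analyticMap (h i) S)
      (fun i => analyticMap (isProperIntertwiner_proj h i) S) := by
  have hdense : Dense (⋃ i, Set.range (analyticMap (isProperIntertwiner_proj h i) S)) := by
    rw [Subtype.dense_iff, Set.image_iUnion]
    have : (⋃ i, Subtype.val '' Set.range (analyticMap (isProperIntertwiner_proj h i) S)) =
        ⋃ i, CrossedProduct.twistedPullback (isProperIntertwiner_proj h i) 1 ''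
          ((β i).analytic S : Set (β i).CrossedProduct) := by
      refine Set.iUnion_congr fun i => ?_
      ext b
      constructor
      · rintro ⟨_, ⟨a, rfl⟩, rfl⟩
        exact ⟨a.1, a.2, rfl⟩
      · rintro ⟨a, ha, rfl⟩
        exact ⟨_, ⟨⟨a, ha⟩, rfl⟩, rfl⟩
    exact (analytic_limit_eq_closure h S).subset.trans (closure_mono this.superset)
  have hnorm (i : ℕ) (a : (β i).analytic S) :
      ‖analyticMap (isProperIntertwiner_proj h i) S a‖ = ‖a‖ := norm_twistedPullback_one _ a.1
  have hsucc (i : ℕ) (a : (β i).analytic S) :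
      analyticMap (isProperIntertwiner_proj h (i + 1)) S (analyticMap (h i) S a) =
        analyticMap (isProperIntertwiner_proj h i) S a :=
    Subtype.ext (twistedPullback_proj_succ h i a.1)
  refine ⟨fun i => (isClosed_analytic S).completeSpace_coe,
    (isClosed_analytic S).completeSpace_coe, fun i a => (norm_twistedPullback_one (h i) a.1).le,
    fun i a => (hnorm i a).le, hsucc, fun C _ _ _ _ _ ψ hcontr hψ => ?_⟩
  obtain ⟨χ, hχ, hχψ⟩ := exists_contractive_hom hnorm hsucc hdense hcontr hψ
  refine ⟨χ, ⟨hχ, hχψ⟩, fun χ' ⟨hχ', hχψ'⟩ => ?_⟩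
  have hcont {χ : (limit h).analytic S →ₙₐ[ℂ] C} (hχ : ∀ b, ‖χ b‖ ≤ ‖b‖) : Continuous χ :=
    (AddMonoidHomClass.lipschitz_of_bound χ 1 fun b => by rw [one_mul]; exact hχ b).continuous
  refine DFunLike.coe_injective (Continuous.ext_on hdense (hcont hχ') (hcont hχ) fun b hb => ?_)
  obtain ⟨i, a, rfl⟩ := Set.mem_iUnion.1 hb
  rw [hχψ, hχψ']

end Sequence

end PartialAction

end

theorem proposition4p1 (G : Type v) [AddCommGroup G] :
    -- a proper intertwining surjection induces an embedding of crossed products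
    (∀ (X Y : Type u) [TopologicalSpace X] [LocallyCompactSpace X] [T2Space X]
      [TopologicalSpace Y] [LocallyCompactSpace Y] [T2Space Y]
      (β : PartialAction G X) (γ : PartialAction G Y) (φ : Y → X),
      PartialAction.IsProperIntertwiner γ β φ →
      ∃ Φ : β.CrossedProduct →⋆ₙₐ[ℂ] γ.CrossedProduct,
        PartialAction.IsInduced γ β φ Φ ∧ Continuous Φ ∧ Function.Injective Φ ∧
        ∀ Φ', PartialAction.IsInduced γ β φ Φ' → Φ' = Φ) ∧
    -- inverse limits of spaces give direct limits of crossed products and analytic subalgebras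
    (∀ (X : ℕ → Type u) [∀ i, TopologicalSpace (X i)] [∀ i, LocallyCompactSpace (X i)]
      [∀ i, T2Space (X i)] (φ : ∀ i, X (i + 1) → X i) (β : ∀ i, PartialAction G (X i)),
      (∀ i, PartialAction.IsProperIntertwiner (β (i + 1)) (β i) (φ i)) →
      LocallyCompactSpace (InvLimit φ) ∧
      ∃ βlim : PartialAction G (InvLimit φ),
        (∀ i, PartialAction.IsProperIntertwiner βlim (β i) (InvLimit.proj φ i)) ∧
        ∀ Φ : ∀ i, (β i).CrossedProduct →⋆ₙₐ[ℂ] (β (i + 1)).CrossedProduct,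
          (∀ i, PartialAction.IsInduced (β (i + 1)) (β i) (φ i) (Φ i)) →
          ∃ Ψ : ∀ i, (β i).CrossedProduct →⋆ₙₐ[ℂ] βlim.CrossedProduct,
            (∀ i, PartialAction.IsInduced βlim (β i) (InvLimit.proj φ i) (Ψ i)) ∧
            IsCStarDirectLimit.{max u v, max u v, w} Φ Ψ ∧
            ∀ S : PositiveCone G,
              (∀ i, ∀ a ∈ (β i).analytic S, Φ i a ∈ (β (i + 1)).analytic S) ∧
              (βlim.analytic S : Set βlim.CrossedProduct) =
                closure (⋃ i, Ψ i '' ((β i).analytic S : Set (β i).CrossedProduct)) ∧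
              ∃ (ΦS : ∀ i, (β i).analytic S →ₙₐ[ℂ] (β (i + 1)).analytic S)
                (ΨS : ∀ i, (β i).analytic S →ₙₐ[ℂ] βlim.analytic S),
                (∀ i a, (ΦS i a : (β (i + 1)).CrossedProduct) = Φ i a) ∧
                (∀ i a, (ΨS i a : βlim.CrossedProduct) = Ψ i a) ∧
                IsBanachDirectLimit.{max u v, max u v, w} (A := fun i => (β i).analytic S)
                  (B := βlim.analytic S) ΦS ΨS) := by
  refine ⟨fun X Y _ _ _ _ _ _ β γ φ h => ?_, fun X _ _ _ φ β h => ⟨?_, ?_⟩⟩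
  · exact ⟨PartialAction.CrossedProduct.twistedPullback h 1,
      (PartialAction.isInduced_iff h _).2 rfl,
      PartialAction.CrossedProduct.continuous_hom _,
      PartialAction.CrossedProduct.injective_twistedPullback_one h,
      fun Φ' => (PartialAction.isInduced_iff h Φ').1⟩
  · exact InvLimit.locallyCompactSpace (fun i => (h i).continuous)
      fun i => (h i).isCompact_preimage
  · refine ⟨PartialAction.limit h, PartialAction.isProperIntertwiner_proj h, fun Φ hΦ => ?_⟩
    obtain rfl : Φ = fun i => PartialAction.CrossedProduct.twistedPullback (h i) 1 :=
      funext fun i => (PartialAction.isInduced_iff (h i) (Φ i)).1 (hΦ i)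
    exact ⟨fun i =>
        PartialAction.CrossedProduct.twistedPullback (PartialAction.isProperIntertwiner_proj h i) 1,
      fun i => (PartialAction.isInduced_iff _ _).2 rfl, PartialAction.isCStarDirectLimit h,
      fun S => ⟨fun i a => PartialAction.twistedPullback_one_mem_analytic (h i) S,
        PartialAction.analytic_limit_eq_closure h S, fun i => PartialAction.analyticMap (h i) S,
        fun i => PartialAction.analyticMap (PartialAction.isProperIntertwiner_proj h i) S,
        fun _ _ => rfl, fun _ _ => rfl, PartialAction.isBanachDirectLimit_analytic h S⟩⟩
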